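/- Call two subsets $L,L'\subset\mathbb R^3$ ambient isotopic if there is a continuous family $(H_t)_{t\in[0,1]}$ of homeomorphisms of $\mathbb R^3$ with $H_0=\mathrm{id}$ and $H_1(L)=L'$. A (tame) link with $n$ components is a subset of $\mathbb R^3$ that is ambient isotopic to a disjoint union of $n$ simple closed polygons; a (tame) knot is a link with $n=1$. For real $r,h,t_i,t_e$ let $[r,h,t_i,t_e]$ denote the arc $t\mapsto(r\cos t,\,r\sin t,\,ht)$, $t_i\le t\le t_e$, and call the eight arcs $$[\tfrac12,\tfrac12,0,\tfrac{\pi}2],\quad [1,0,0,\pi],\quad [\tfrac12,\tfrac12,0,2\pi],\quad [\tfrac12,-\tfrac12,\tfrac{3\pi}2,2\pi],$$ $$[\tfrac12,-\tfrac12,0,2\pi],\quad [\tfrac12,-\tfrac12,0,\tfrac{3\pi}2],\quad [\tfrac12,-\tfrac12,0,\tfrac{\pi}2],\quad [\tfrac12,\tfrac12,0,8\pi]$$ of the unit circle and of helices of radius $\tfrac12$, each parametrized by arclength, the elementary pieces; all of them have curvature $1$. **Theorem.** Every link $L\subset\mathbb R^3$ with $n$ components (in particular every knot) can be represented by $C^2$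 curves of constant nonzero curvature: $L$ is ambient isotopic to a union of $n$ pairwise disjoint simple closed curves, each of which has a periodic $C^2$ arclength parametrization with curvature constantly equal to $1$. Moreover, these curves can be chosen so that each of them is a concatenation of finitely many copies of elementary pieces, every copy being the image of an elementary piece under a rotation followed by a translation. -/

import Mathlib

open Set

/-- Euclidean three-space. -/
abbrev E3 : Type := EuclideanSpace ℝ (Fin 3)

/-- `L` and `L'` are ambient isotopic: there is a continuous family `H t`, `t ∈ [0,1]`, of
homeomorphisms of `ℝ³` starting at the identity and ending at one that carries `L` onto `L'`. -/
def AmbientIsotopic (L L' : Set E3) : Prop :=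
  ∃ H : unitInterval → (E3 ≃ₜ E3),
    Continuous (fun p : unitInterval × E3 => H p.1 p.2) ∧
    (∀ x, H 0 x = x) ∧ H 1 '' L = L'

/-- A polygonal link with `n` components: the `i`-th component is the closed polygon with
cyclically ordered vertices `vertex i 0, vertex i 1, …, vertex i (m i - 1)`, where `m i ≥ 3`.
The half-open edges `[v k, v (k+1))` of all the components are pairwise disjoint; this says that
each polygon is simple (in particular nondegenerate) and that distinct components are disjoint. -/
structure PolygonalLink (n : ℕ) where
  m : Fin n → ℕ
  three_le : ∀ i, 3 ≤ m i
  vertex : (i : Fin n) → ZMod (m i) → E3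
  simple : Pairwise fun e e' : (Σ i : Fin n, ZMod (m i)) =>
    Disjoint
      (AffineMap.lineMap (k := ℝ) (vertex e.1 e.2) (vertex e.1 (e.2 + 1)) '' Ico (0 : ℝ) 1)
      (AffineMap.lineMap (k := ℝ) (vertex e'.1 e'.2) (vertex e'.1 (e'.2 + 1)) '' Ico (0 : ℝ) 1)

/-- The point set of a polygonal link: the union of all its edges. -/
def PolygonalLink.carrier {n : ℕ} (P : PolygonalLink n) : Set E3 :=
  ⋃ i, ⋃ k : ZMod (P.m i), segment ℝ (P.vertex i k) (P.vertex i (k + 1))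

/-- A (tame) link with `n` components: a subset of `ℝ³` that is ambient isotopic to a polygonal
link with `n` components. A (tame) knot is the case `n = 1`. -/
def IsTameLink (n : ℕ) (L : Set E3) : Prop :=
  ∃ P : PolygonalLink n, AmbientIsotopic P.carrier L

/-- A `C²` link with `n` components, each parametrized by arclength: the `i`-th component is the
simple closed curve of length `length i` given by the periodic unit-speed curve `γ i`, and distinct
components are disjoint. -/
structure C2Link (n : ℕ) where
  length : Fin n → ℝ
  length_pos : ∀ i, 0 < length i
  γ : Fin n → ℝ → E3
  contDiff : ∀ i, ContDiff ℝ 2 (γ i)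
  unitSpeed : ∀ i s, ‖deriv (γ i) s‖ = 1
  periodic : ∀ i, Function.Periodic (γ i) (length i)
  simple : ∀ i j s t, γ i s = γ j t → i = j ∧ ∃ z : ℤ, t = s + z * length i

/-- The point set of a `C²` link. -/
def C2Link.carrier {n : ℕ} (C : C2Link n) : Set E3 := ⋃ i, range (C.γ i)

/-- The curvature of a unit-speed curve at the parameter `s`: the length of its second
derivative. -/
noncomputable def curvature (γ : ℝ → E3) (s : ℝ) : ℝ := ‖deriv (deriv γ) s‖

/-- All components of the link have the same constant curvature `κ`. -/
def C2Link.HasConstantCurvature {n : ℕ} (C : C2Link n) (κ : ℝ) : Prop :=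
  ∀ i s, curvature (C.γ i) s = κ

/-- The piece `[r, h, ti, te]` of the helix `t ↦ (r cos t, r sin t, h t)`, from the parameter `ti`
to the parameter `te` (a circular arc if `h = 0`). -/
structure HelixPiece where
  r : ℝ
  h : ℝ
  ti : ℝ
  te : ℝ

/-- The arclength of a helix piece. -/
noncomputable def HelixPiece.length (p : HelixPiece) : ℝ :=
  √(p.r ^ 2 + p.h ^ 2) * (p.te - p.ti)

/-- The arclength parametrization of a helix piece, on `[0, p.length]`. -/
noncomputable def HelixPiece.arc (p : HelixPiece) (s : ℝ) : E3 :=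
  let t := p.ti + s / √(p.r ^ 2 + p.h ^ 2)
  !₂[p.r * Real.cos t, p.r * Real.sin t, p.h * t]

/-- The elementary pieces `a, b, c, d, e, f, g, l`: arcs of the unit circle and of the two helices
with `r = 1/2`, `h = ± 1/2`. -/
noncomputable def elementaryPieces : Set HelixPiece :=
  { ⟨1 / 2, 1 / 2, 0, Real.pi / 2⟩,
    ⟨1, 0, 0, Real.pi⟩,
    ⟨1 / 2, 1 / 2, 0, 2 * Real.pi⟩,
    ⟨1 / 2, -1 / 2, 3 * Real.pi / 2, 2 * Real.pi⟩,
    ⟨1 / 2, -1 / 2, 0, 2 * Real.pi⟩,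
    ⟨1 / 2, -1 / 2, 0, 3 * Real.pi / 2⟩,
    ⟨1 / 2, -1 / 2, 0, Real.pi / 2⟩,
    ⟨1 / 2, 1 / 2, 0, 8 * Real.pi⟩ }

/-- The curve `γ` on `[0, ℓ]` is a finite concatenation of copies of elementary pieces, each copy
being obtained by a rotation `A` and a translation by `w`. -/
def IsConcatOfElementaryPieces (γ : ℝ → E3) (ℓ : ℝ) : Prop :=
  ∃ (N : ℕ) (t : Fin (N + 1) → ℝ), t 0 = 0 ∧ t (Fin.last N) = ℓ ∧
    ∀ k : Fin N, ∃ p ∈ elementaryPieces, ∃ (A : E3 ≃ₗᵢ[ℝ] E3) (w : E3),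
      LinearMap.det (A.toLinearEquiv : E3 →ₗ[ℝ] E3) = 1 ∧
      t k.succ = t k.castSucc + p.length ∧
      ∀ s ∈ Icc 0 p.length, γ (t k.castSucc + s) = A (p.arc s) + w

theorem AmbientIsotopic.refl (L : Set E3) : AmbientIsotopic L L :=
  ⟨fun _ => Homeomorph.refl E3, by simpa using continuous_snd, fun _ => rfl, by simp⟩

theorem AmbientIsotopic.trans {L M N : Set E3} (h : AmbientIsotopic L M)
    (h' : AmbientIsotopic M N) : AmbientIsotopic L N := by
  obtain ⟨H, hc, h0, h1⟩ := h
  obtain ⟨H', hc', h0', h1'⟩ := h'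
  refine ⟨fun t => (H t).trans (H' t), ?_, ?_, ?_⟩
  · exact hc'.comp (continuous_fst.prodMk hc)
  · intro x; simp [h0, h0']
  · rw [← h1', ← h1, ← image_comp]; rfl

theorem AmbientIsotopic.symm {L M : Set E3} (h : AmbientIsotopic L M) : AmbientIsotopic M L := by
  obtain ⟨H, hc, h0, h1⟩ := h
  refine ⟨fun t => (H 1).symm.trans (H (unitInterval.symm t)), ?_, ?_, ?_⟩
  · exact hc.comp ((unitInterval.continuous_symm.comp continuous_fst).prodMk
      ((H 1).symm.continuous.comp continuous_snd))
  · intro x; simp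
  · rw [← h1, ← image_comp]
    ext x; simp [h0]

/-- A displacement with small Lipschitz constant, relative to the chordal distance, extends to an
ambient isotopy. -/
theorem exists_ambientIsotopic_of_displacement :
    ∃ K : ℝ, 0 < K ∧ ∀ {ι : Type} (φ ψ : ι → E3),
      (∀ a b, ‖(ψ a - φ a) - (ψ b - φ b)‖ ≤ K * ‖φ a - φ b‖) →
      AmbientIsotopic (range φ) (range ψ) := by
  set c := lipschitzExtensionConstant E3 with hc
  have hc0 : 0 < c := lipschitzExtensionConstant_pos E3
  refine ⟨(1 / (2 * c) : NNReal), by positivity, fun {ι} φ ψ h => ?_⟩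
  classical
  let d : E3 → E3 := fun x => if hx : x ∈ range φ then ψ hx.choose - φ hx.choose else 0
  have hd : ∀ a, d (φ a) = ψ a - φ a := by
    intro a
    have hx : φ a ∈ range φ := ⟨a, rfl⟩
    have := h hx.choose a
    rw [hx.choose_spec, sub_self, norm_zero, mul_zero, norm_le_zero_iff, sub_eq_zero] at this
    simp only [d, dif_pos hx]
    rw [hx.choose_spec]; exact this
  have hL : LipschitzOnWith (1 / (2 * c)) d (range φ) := by
    refine LipschitzOnWith.of_dist_le_mul ?_
    rintro _ ⟨a, rfl⟩ _ ⟨b, rfl⟩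
    rw [hd, hd, dist_eq_norm, dist_eq_norm]; exact h a b
  obtain ⟨g, hg, hgd⟩ := hL.extend_finite_dimension
  have hk : c * (1 / (2 * c)) = 1 / 2 := by field_simp
  rw [← hc, hk] at hg
  have happ : ∀ t : unitInterval, ApproximatesLinearOn (fun x => x + (t : ℝ) • g x)
      ((ContinuousLinearEquiv.refl ℝ E3 : E3 ≃L[ℝ] E3) : E3 →L[ℝ] E3) univ (1 / 2) := by
    intro t x _ y _
    have h1 := hg.norm_sub_le x y
    have : x + (t : ℝ) • g x - (y + (t : ℝ) • g y) -
        ((ContinuousLinearEquiv.refl ℝ E3 : E3 ≃L[ℝ] E3) : E3 →L[ℝ] E3) (x - y)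
        = (t : ℝ) • (g x - g y) := by
      simp [smul_sub]; abel
    rw [this, norm_smul, Real.norm_of_nonneg t.2.1]
    calc (t : ℝ) * ‖g x - g y‖ ≤ 1 * ‖g x - g y‖ := by gcongr; exact t.2.2
      _ ≤ _ := by simpa using h1
  have hN : Subsingleton E3 ∨ (1 / 2 : NNReal) <
      ‖((ContinuousLinearEquiv.refl ℝ E3).symm : E3 →L[ℝ] E3)‖₊⁻¹ := by
    right
    have : ‖((ContinuousLinearEquiv.refl ℝ E3).symm : E3 →L[ℝ] E3)‖₊ = 1 :=
      NNReal.eq (ContinuousLinearMap.norm_id (𝕜 := ℝ) (E := E3))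
    rw [this, inv_one]
    exact NNReal.half_lt_self one_ne_zero
  refine ⟨fun t => (happ t).toHomeomorph _ hN, ?_, ?_, ?_⟩
  · change Continuous fun p : unitInterval × E3 => p.2 + (p.1 : ℝ) • g p.2
    have := hg.continuous
    fun_prop
  · intro x
    change x + ((0 : unitInterval) : ℝ) • g x = x
    simp
  · change (fun x => x + ((1 : unitInterval) : ℝ) • g x) '' range φ = range ψ
    rw [← range_comp]
    congr 1
    ext1 a
    have : g (φ a) = ψ a - φ a := by rw [← hgd ⟨a, rfl⟩, hd]
    simp [this]

/-- The linear homotopy between two maps. -/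
def linHomotopy {ι : Type} (γ₀ γ₁ : ι → E3) (s : ℝ) (a : ι) : E3 := γ₀ a + s • (γ₁ a - γ₀ a)

theorem ambientIsotopic_of_linHomotopy {ι : Type} (γ₀ γ₁ : ι → E3) (C : ℝ)
    (h : ∀ s ∈ Icc (0 : ℝ) 1, ∀ a b, ‖(γ₁ a - γ₀ a) - (γ₁ b - γ₀ b)‖ ≤
      C * ‖linHomotopy γ₀ γ₁ s a - linHomotopy γ₀ γ₁ s b‖) :
    AmbientIsotopic (range γ₀) (range γ₁) := by
  obtain ⟨K, hK, H⟩ := exists_ambientIsotopic_of_displacement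
  obtain ⟨N, hN⟩ := exists_nat_gt (|C| / K)
  have hN0 : (0 : ℝ) < N := lt_of_le_of_lt (by positivity) hN
  have key : ∀ k : ℕ, k ≤ N →
      AmbientIsotopic (range γ₀) (range (linHomotopy γ₀ γ₁ (k / N))) := by
    intro k
    induction k with
    | zero => intro _; convert AmbientIsotopic.refl _; ext1 a; simp [linHomotopy]
    | succ k ih =>
      intro hk
      refine (ih (by omega)).trans (H _ _ fun a b => ?_)
      have hk' : (k : ℝ) ≤ N := by exact_mod_cast (by omega : k ≤ N)
      have hs : (k / N : ℝ) ∈ Icc (0 : ℝ) 1 := ⟨by positivity, by rw [div_le_one hN0]; exact hk'⟩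
      have h1 := h _ hs a b
      have : linHomotopy γ₀ γ₁ ((k + 1 : ℕ) / N) a - linHomotopy γ₀ γ₁ (k / N) a -
          (linHomotopy γ₀ γ₁ ((k + 1 : ℕ) / N) b - linHomotopy γ₀ γ₁ (k / N) b)
          = (1 / N : ℝ) • ((γ₁ a - γ₀ a) - (γ₁ b - γ₀ b)) := by
        simp only [linHomotopy]
        push_cast
        rw [add_div]
        module
      rw [this, norm_smul, Real.norm_of_nonneg (by positivity)]
      have h2 : C ≤ K * N := by
        rw [div_lt_iff₀ hK] at hN
        linarith [le_abs_self C]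
      calc 1 / (N : ℝ) * ‖(γ₁ a - γ₀ a) - (γ₁ b - γ₀ b)‖
          ≤ 1 / N * (K * N * ‖linHomotopy γ₀ γ₁ (k / N) a - linHomotopy γ₀ γ₁ (k / N) b‖) := by
            gcongr; exact h1.trans (by gcongr)
        _ = _ := by field_simp
  convert key N le_rfl
  rw [div_self hN0.ne']
  ext1 a
  simp [linHomotopy]

/-- The union of the images of a finite family of curves. -/
def carrierOf {n : ℕ} (γ : Fin n → ℝ → E3) : Set E3 := ⋃ i, range (γ i)

theorem carrierOf_eq_range {n : ℕ} (γ : Fin n → ℝ → E3) :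
    carrierOf γ = range fun p : Fin n × ℝ => γ p.1 p.2 := by
  ext x; simp [carrierOf]

/-- Two parameters of a family of closed curves with periods `per` that are further than `W`
apart. -/
def Far {n : ℕ} (per : Fin n → ℝ) (W : ℝ) (i : Fin n) (u : ℝ) (j : Fin n) (v : ℝ) : Prop :=
  i = j → ∀ z : ℤ, W < |v - u + z * per i|

theorem ambientIsotopic_of_near_far {n : ℕ} (per : Fin n → ℝ) (γ₀ γ₁ : Fin n → ℝ → E3)
    (h₀ : ∀ i, Function.Periodic (γ₀ i) (per i)) (h₁ : ∀ i, Function.Periodic (γ₁ i) (per i))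
    {W κ Λ ρ : ℝ} (hκ : 0 < κ) (hρ : 0 < ρ)
    (near : ∀ i u v, u ≤ v → v ≤ u + W → ∀ s ∈ Icc (0 : ℝ) 1,
      κ * (v - u) ≤ ‖linHomotopy (γ₀ i) (γ₁ i) s v - linHomotopy (γ₀ i) (γ₁ i) s u‖)
    (lip : ∀ i u v, u ≤ v → v ≤ u + W →
      ‖(γ₁ i v - γ₀ i v) - (γ₁ i u - γ₀ i u)‖ ≤ Λ * (v - u))
    (far : ∀ i u j v, Far per W i u j v → 3 * ρ ≤ ‖γ₀ i u - γ₀ j v‖)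
    (close : ∀ i u, ‖γ₁ i u - γ₀ i u‖ ≤ ρ) :
    AmbientIsotopic (carrierOf γ₀) (carrierOf γ₁) := by
  rw [carrierOf_eq_range, carrierOf_eq_range]
  refine ambientIsotopic_of_linHomotopy _ _ (max (|Λ| / κ) 2) ?_
  rintro s hs ⟨i, u⟩ ⟨j, v⟩
  set C := max (|Λ| / κ) 2 with hC
  have hC0 : 0 ≤ C := le_max_of_le_right (by norm_num)
  have nearC : ∀ i u v, u ≤ v → v ≤ u + W →
      ‖(γ₁ i v - γ₀ i v) - (γ₁ i u - γ₀ i u)‖ ≤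
        C * ‖linHomotopy (γ₀ i) (γ₁ i) s v - linHomotopy (γ₀ i) (γ₁ i) s u‖ := by
    intro i u v huv hv
    have h1 := near i u v huv hv s hs
    have h2 := lip i u v huv hv
    have h3 : Λ ≤ C * κ := by
      have : |Λ| / κ ≤ C := le_max_left _ _
      rw [div_le_iff₀ hκ] at this
      exact (le_abs_self _).trans this
    calc _ ≤ Λ * (v - u) := h2
      _ ≤ C * κ * (v - u) := by gcongr
      _ = C * (κ * (v - u)) := by ring
      _ ≤ _ := by gcongr
  change ‖(γ₁ i u - γ₀ i u) - (γ₁ j v - γ₀ j v)‖ ≤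
    C * ‖linHomotopy (γ₀ i) (γ₁ i) s u - linHomotopy (γ₀ j) (γ₁ j) s v‖
  by_cases hf : Far per W i u j v
  · have h1 := far i u j v hf
    have h2 := close i u
    have h3 := close j v
    have h4 : ‖(γ₁ i u - γ₀ i u) - (γ₁ j v - γ₀ j v)‖ ≤ 2 * ρ :=
      (norm_sub_le _ _).trans (by linarith)
    have h5 : ρ ≤ ‖linHomotopy (γ₀ i) (γ₁ i) s u - linHomotopy (γ₀ j) (γ₁ j) s v‖ := by
      have e : γ₀ i u - γ₀ j v = (linHomotopy (γ₀ i) (γ₁ i) s u - linHomotopy (γ₀ j) (γ₁ j) s v) -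
          s • ((γ₁ i u - γ₀ i u) - (γ₁ j v - γ₀ j v)) := by
        simp only [linHomotopy]; module
      have h6 := norm_sub_le (linHomotopy (γ₀ i) (γ₁ i) s u - linHomotopy (γ₀ j) (γ₁ j) s v)
        (s • ((γ₁ i u - γ₀ i u) - (γ₁ j v - γ₀ j v)))
      rw [← e, norm_smul, Real.norm_of_nonneg hs.1] at h6
      have : s * ‖(γ₁ i u - γ₀ i u) - (γ₁ j v - γ₀ j v)‖ ≤ 1 * (2 * ρ) := by
        gcongr; exact hs.2
      linarith
    calc _ ≤ 2 * ρ := h4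
      _ ≤ C * ρ := by gcongr; exact le_max_right _ _
      _ ≤ _ := by gcongr
  · unfold Far at hf
    push Not at hf
    obtain ⟨rfl, z, hz⟩ := hf
    have e0 : γ₀ i v = γ₀ i (v + z * per i) := ((h₀ i).int_mul z v).symm
    have e1 : γ₁ i v = γ₁ i (v + z * per i) := ((h₁ i).int_mul z v).symm
    have eL : linHomotopy (γ₀ i) (γ₁ i) s v = linHomotopy (γ₀ i) (γ₁ i) s (v + z * per i) := by
      simp only [linHomotopy, e0.symm, e1.symm]
    rw [e0, e1, eL]
    obtain ⟨hz1, hz2⟩ := abs_le.1 hz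
    rcases le_total u (v + z * per i) with h | h
    · have := nearC i u (v + z * per i) h (by linarith)
      rwa [norm_sub_rev, norm_sub_rev (linHomotopy _ _ _ _)]
    · exact nearC i (v + z * per i) u h (by linarith)

open Filter Topology in
/-- For closed curves without double points, parameters that are far apart have images that are
uniformly far apart. -/
theorem exists_far_bound {n : ℕ} (per : Fin n → ℝ) (hper : ∀ i, 0 < per i) (γ : Fin n → ℝ → E3)
    (hc : ∀ i, Continuous (γ i)) (hp : ∀ i, Function.Periodic (γ i) (per i))
    (hinj : ∀ i j u v, γ i u = γ j v → i = j ∧ ∃ z : ℤ, v = u + z * per i) {W : ℝ} (hW : 0 < W) :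
    ∃ ρ > 0, ∀ i u j v, Far per W i u j v → ρ ≤ ‖γ i u - γ j v‖ := by
  have key : ∀ i j, ∀ᶠ ρ in 𝓝[>] (0 : ℝ), ∀ u v, Far per W i u j v → ρ ≤ ‖γ i u - γ j v‖ := by
    intro i j
    let S : Set (ℝ × ℝ) := (Icc 0 (per i) ×ˢ Icc 0 (per j)) ∩
      {p | i = j → ∀ z : ℤ, W ≤ |p.2 - p.1 + z * per i|}
    have hS : IsCompact S := by
      refine (isCompact_Icc.prod isCompact_Icc).inter_right ?_
      by_cases hij : i = j
      · simp only [hij, true_imp_iff, ofPred_forall]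
        exact isClosed_iInter fun z => isClosed_le (by fun_prop) (by fun_prop)
      · simp [hij]
    have hcont : Continuous fun p : ℝ × ℝ => ‖γ i p.1 - γ j p.2‖ := by
      have := hc i; have := hc j; fun_prop
    have hred : ∀ u v, Far per W i u j v → ∃ p ∈ S, γ i p.1 = γ i u ∧ γ j p.2 = γ j v := by
      intro u v h
      have e1 : toIcoMod (hper i) 0 u = u - toIcoDiv (hper i) 0 u * per i := by
        rw [toIcoMod, zsmul_eq_mul]
      have e2 : toIcoMod (hper j) 0 v = v - toIcoDiv (hper j) 0 v * per j := by
        rw [toIcoMod, zsmul_eq_mul]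
      refine ⟨(toIcoMod (hper i) 0 u, toIcoMod (hper j) 0 v), ⟨⟨?_, ?_⟩, ?_⟩, ?_, ?_⟩
      · simpa using Ico_subset_Icc_self (toIcoMod_mem_Ico (hper i) 0 u)
      · simpa using Ico_subset_Icc_self (toIcoMod_mem_Ico (hper j) 0 v)
      · intro hij z
        have := h hij (z + toIcoDiv (hper i) 0 u - toIcoDiv (hper j) 0 v)
        subst hij
        refine this.le.trans (le_of_eq ?_)
        simp only [e1, e2]
        push_cast
        ring_nf
      · simp only [e1]; exact (hp i).sub_int_mul_eq _
      · simp only [e2]; exact (hp j).sub_int_mul_eq _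
    rcases S.eq_empty_or_nonempty with he | hne
    · filter_upwards with ρ u v h
      obtain ⟨p, hpS, -⟩ := hred u v h
      simp [he] at hpS
    · obtain ⟨p, hpS, hmin⟩ := hS.exists_isMinOn hne hcont.continuousOn
      have hpos : 0 < ‖γ i p.1 - γ j p.2‖ := by
        rw [norm_pos_iff, sub_ne_zero]
        intro h
        obtain ⟨hij, z, hz⟩ := hinj _ _ _ _ h
        have := hpS.2 hij (-z)
        rw [hz] at this
        simp at this
        linarith
      filter_upwards [Ioc_mem_nhdsGT hpos] with ρ hρ u v h
      obtain ⟨q, hqS, h1, h2⟩ := hred u v h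
      rw [← h1, ← h2]
      exact hρ.2.trans (hmin hqS)
  have key' := (eventually_all.2 fun i => eventually_all.2 fun j => key i j).and self_mem_nhdsWithin
  obtain ⟨ρ, h, hρ⟩ := key'.exists
  exact ⟨ρ, hρ, fun i u j v => h i j u v⟩

/-- The broken line with vertices `V k`, passing through `V k` at time `k`. -/
noncomputable def polyCurve (V : ℤ → E3) (x : ℝ) : E3 :=
  V ⌊x⌋ + Int.fract x • (V (⌊x⌋ + 1) - V ⌊x⌋)

theorem polyCurve_eq (V : ℤ → E3) {k : ℤ} {x : ℝ} (h : (k : ℝ) ≤ x) (h' : x ≤ k + 1) :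
    polyCurve V x = V k + (x - k) • (V (k + 1) - V k) := by
  rcases h'.lt_or_eq with h' | h'
  · have : ⌊x⌋ = k := Int.floor_eq_iff.2 ⟨h, h'⟩
    simp [polyCurve, Int.fract, this]
  · have : x = ((k + 1 : ℤ) : ℝ) := by push_cast; exact h'
    rw [polyCurve, this, Int.floor_intCast, Int.fract_intCast]
    push_cast
    module

theorem polyCurve_periodic {V : ℤ → E3} {m : ℤ} (h : ∀ k, V (k + m) = V k) :
    Function.Periodic (polyCurve V) m := by
  intro x
  have := h (⌊x⌋ + 1)
  rw [show ⌊x⌋ + 1 + m = ⌊x⌋ + m + 1 by ring] at this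
  simp [polyCurve, h, this]

theorem polyCurve_sub {V : ℤ → E3} {k : ℤ} {x y : ℝ} (hx : (k : ℝ) - 1 ≤ x) (hxy : x ≤ y)
    (hy : y ≤ k + 1) : ∃ a b : ℝ, 0 ≤ a ∧ 0 ≤ b ∧ a + b = y - x ∧
      polyCurve V y - polyCurve V x = a • (V k - V (k - 1)) + b • (V (k + 1) - V k) := by
  have e1 : ∀ x : ℝ, (k : ℝ) - 1 ≤ x → x ≤ k →
      polyCurve V x = V (k - 1) + (x - (k - 1)) • (V k - V (k - 1)) := by
    intro x h h'
    rw [polyCurve_eq V (k := k - 1) (by push_cast; exact h) (by push_cast; linarith)]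
    push_cast
    rw [sub_add_cancel]
  rcases le_total y k with h | h
  · refine ⟨y - x, 0, by linarith, le_rfl, by ring, ?_⟩
    rw [e1 y (by linarith) h, e1 x hx (by linarith)]
    module
  rcases le_total x k with h' | h'
  · refine ⟨k - x, y - k, by linarith, by linarith, by ring, ?_⟩
    rw [e1 x hx h', polyCurve_eq V h hy]
    module
  · refine ⟨0, y - x, le_rfl, by linarith, by ring, ?_⟩
    rw [polyCurve_eq V h' (by linarith), polyCurve_eq V h hy]
    module

theorem polyCurve_lip {V : ℤ → E3} {B : ℝ} (hB : ∀ k, ‖V (k + 1) - V k‖ ≤ B) {x y : ℝ}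
    (hxy : x ≤ y) (hy : y ≤ x + 1) : ‖polyCurve V y - polyCurve V x‖ ≤ B * (y - x) := by
  have h1 := Int.floor_le y
  have h2 := Int.lt_floor_add_one y
  obtain ⟨a, b, ha, hb, hab, h⟩ := polyCurve_sub (V := V) (k := ⌊y⌋) (x := x) (y := y)
    (by linarith) hxy h2.le
  rw [h, ← hab]
  have h3 := hB (⌊y⌋ - 1)
  rw [sub_add_cancel] at h3
  calc _ ≤ a * ‖V ⌊y⌋ - V (⌊y⌋ - 1)‖ + b * ‖V (⌊y⌋ + 1) - V ⌊y⌋‖ := by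
        refine (norm_add_le _ _).trans ?_
        rw [norm_smul, norm_smul, Real.norm_of_nonneg ha, Real.norm_of_nonneg hb]
    _ ≤ a * B + b * B := by gcongr; exact hB _
    _ = _ := by ring

theorem continuous_of_lip_near {f : ℝ → E3} {B : ℝ}
    (h : ∀ x y, x ≤ y → y ≤ x + 1 → ‖f y - f x‖ ≤ B * (y - x)) : Continuous f := by
  rw [continuous_iff_continuousAt]
  intro x
  rw [ContinuousAt, tendsto_iff_norm_sub_tendsto_zero]
  have h0 : Filter.Tendsto (fun y => B * |y - x|) (nhds x) (nhds 0) := by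
    have : Continuous fun y : ℝ => B * |y - x| := by fun_prop
    simpa using this.tendsto x
  refine squeeze_zero' (Filter.Eventually.of_forall fun _ => norm_nonneg _) ?_ h0
  filter_upwards [Ioo_mem_nhds (show x - 1 < x by linarith) (show x < x + 1 by linarith)] with y hy
  rcases le_total x y with hxy | hxy
  · rw [abs_of_nonneg (by linarith)]; exact h x y hxy hy.2.le
  · rw [abs_of_nonpos (by linarith), norm_sub_rev, neg_sub]; exact h y x hxy (by linarith [hy.1])

namespace PolygonalLink
variable {n : ℕ} (P : PolygonalLink n)

/-- The vertices of a component, indexed periodically by the integers. -/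
def vert (i : Fin n) (k : ℤ) : E3 := P.vertex i k

theorem vert_add (i : Fin n) (k : ℤ) : P.vert i (k + P.m i) = P.vert i k := by
  simp [vert]

theorem m_pos (i : Fin n) : 0 < P.m i := by have := P.three_le i; omega

theorem mem_edge (i : Fin n) (k : ℤ) {t : ℝ} (ht : t ∈ Ico (0 : ℝ) 1) :
    P.vert i k + t • (P.vert i (k + 1) - P.vert i k) ∈
      AffineMap.lineMap (k := ℝ) (P.vertex i k) (P.vertex i (k + 1)) '' Ico (0 : ℝ) 1 :=
  ⟨t, ht, by simp [AffineMap.lineMap_apply, vert, add_comm]⟩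

theorem carrier_eq : P.carrier = carrierOf fun i => polyCurve (P.vert i) := by
  ext x
  simp only [carrier, carrierOf, mem_iUnion, segment_eq_image_lineMap]
  constructor
  · rintro ⟨i, k, t, ht, rfl⟩
    refine ⟨i, ((k.cast : ℤ) : ℝ) + t, ?_⟩
    rw [polyCurve_eq (k := k.cast) _ (by linarith [ht.1]) (by linarith [ht.2])]
    simp [vert, AffineMap.lineMap_apply, add_comm]
  · rintro ⟨i, u, rfl⟩
    refine ⟨i, (⌊u⌋ : ZMod (P.m i)), Int.fract u, ⟨Int.fract_nonneg u, (Int.fract_lt_one u).le⟩, ?_⟩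
    simp [polyCurve, vert, AffineMap.lineMap_apply, add_comm]

theorem intCast_add_one_ne (i : Fin n) (k : ZMod (P.m i)) : k + 1 ≠ k := by
  have : Fact (1 < P.m i) := ⟨by have := P.three_le i; omega⟩
  simp

theorem vert_succ_ne (i : Fin n) (k : ℤ) : P.vert i (k + 1) ≠ P.vert i k := by
  intro h
  have hne : (⟨i, (k : ZMod (P.m i)) + 1⟩ : Σ i : Fin n, ZMod (P.m i)) ≠ ⟨i, k⟩ := by
    intro h; simp at h; exact P.intCast_add_one_ne i k (by simpa using h)
  refine (disjoint_left.1 (P.simple hne)) ?_ (P.mem_edge i k (t := 0) (by simp))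
  have := P.mem_edge i (k + 1) (t := 0) (by simp)
  simp only [zero_smul, add_zero, h] at this ⊢
  simpa using this

theorem polyCurve_inj (i j : Fin n) (u v : ℝ)
    (h : polyCurve (P.vert i) u = polyCurve (P.vert j) v) :
    i = j ∧ ∃ z : ℤ, v = u + z * (P.m i : ℝ) := by
  have hu := P.mem_edge i ⌊u⌋ ⟨Int.fract_nonneg u, Int.fract_lt_one u⟩
  have hv := P.mem_edge j ⌊v⌋ ⟨Int.fract_nonneg v, Int.fract_lt_one v⟩
  have he : (⟨i, (⌊u⌋ : ZMod (P.m i))⟩ : Σ i : Fin n, ZMod (P.m i)) = ⟨j, (⌊v⌋ : ZMod (P.m j))⟩ := by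
    by_contra hne
    refine (disjoint_left.1 (P.simple hne)) hu ?_
    change polyCurve (P.vert i) u ∈ _
    rw [h]; exact hv
  obtain ⟨rfl, he⟩ := Sigma.mk.inj_iff.1 he
  refine ⟨rfl, ?_⟩
  have he := eq_of_heq he
  have e1 : P.vert i ⌊v⌋ = P.vert i ⌊u⌋ := by simp [vert, he]
  have e2 : P.vert i (⌊v⌋ + 1) = P.vert i (⌊u⌋ + 1) := by simp [vert, he]
  simp only [polyCurve, e1, e2, add_right_inj] at h
  have hf := smul_left_injective ℝ (sub_ne_zero.2 (P.vert_succ_ne i ⌊u⌋)) h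
  obtain ⟨z, hz⟩ := (ZMod.intCast_eq_intCast_iff_dvd_sub _ _ _).1 he
  refine ⟨z, ?_⟩
  have hz' : ((⌊v⌋ : ℝ) - ⌊u⌋) = P.m i * z := by exact_mod_cast hz
  have a1 := Int.floor_add_fract u
  have a2 := Int.floor_add_fract v
  linarith

theorem exists_vertex_functional (i : Fin n) (k : ℤ) : ∃ μ : E3, ‖μ‖ ≤ 1 ∧
    0 < inner ℝ μ (P.vert i k - P.vert i (k - 1)) ∧
    0 < inner ℝ μ (P.vert i (k + 1) - P.vert i k) := by
  set w := P.vert i k - P.vert i (k - 1) with hw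
  set w' := P.vert i (k + 1) - P.vert i k with hw'
  have h0 : w ≠ 0 := by
    have := P.vert_succ_ne i (k - 1); rw [sub_add_cancel] at this; exact sub_ne_zero.2 this
  have h0' : w' ≠ 0 := sub_ne_zero.2 (P.vert_succ_ne i k)
  have hp := norm_pos_iff.2 h0
  have hp' := norm_pos_iff.2 h0'
  have hne : inner ℝ w w' ≠ -(‖w‖ * ‖w'‖) := by
    intro h
    have h1 : inner ℝ w (-w') = ‖w‖ * ‖-w'‖ := by rw [inner_neg_right, h, norm_neg, neg_neg]
    rw [inner_eq_norm_mul_iff_real, norm_neg] at h1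
    set a := ‖w‖
    set b := ‖w'‖
    set M := a + b
    have hM : 0 < M := by positivity
    have hne : (⟨i, ((k - 1 : ℤ) : ZMod (P.m i))⟩ : Σ i : Fin n, ZMod (P.m i)) ≠ ⟨i, (k : ℤ)⟩ := by
      intro h
      refine P.intCast_add_one_ne i ((k : ZMod (P.m i)) - 1) ?_
      rw [sub_add_cancel]
      have := eq_of_heq (Sigma.mk.inj_iff.1 h).2
      push_cast at this
      exact this.symm
    have t1 : (1 - b / (2 * M)) ∈ Ico (0 : ℝ) 1 := by
      refine ⟨?_, by have : 0 < b / (2 * M) := by positivity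
                     linarith⟩
      rw [sub_nonneg, div_le_one (by positivity)]
      linarith
    have t2 : (a / (2 * M)) ∈ Ico (0 : ℝ) 1 := by
      refine ⟨by positivity, ?_⟩
      rw [div_lt_one (by positivity)]
      linarith
    refine (disjoint_left.1 (P.simple hne)) (P.mem_edge i (k - 1) t1) ?_
    have := P.mem_edge i k t2
    convert this using 1
    rw [sub_add_cancel, ← hw, ← hw']
    have e : P.vert i k = P.vert i (k - 1) + w := by rw [hw]; abel
    rw [e]
    have : (b / (2 * M)) • w = -((a / (2 * M)) • w') := by
      have := congrArg (fun x => (1 / (2 * M)) • x) h1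
      simp only [smul_smul, smul_neg] at this
      rw [show b / (2 * M) = 1 / (2 * M) * b by ring, show a / (2 * M) = 1 / (2 * M) * a by ring,
        this]
    rw [sub_smul, this, one_smul]; abel
  have hgt : -(‖w‖ * ‖w'‖) < inner ℝ w w' :=
    lt_of_le_of_ne (neg_le_of_abs_le (abs_real_inner_le_norm w w')) (Ne.symm hne)
  refine ⟨(1 / 2 : ℝ) • ((1 / ‖w‖) • w + (1 / ‖w'‖) • w'), ?_, ?_, ?_⟩
  · rw [norm_smul]
    have : ‖(1 / ‖w‖) • w + (1 / ‖w'‖) • w'‖ ≤ 1 + 1 := by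
      refine (norm_add_le _ _).trans (le_of_eq ?_)
      rw [norm_smul, norm_smul]
      simp [hp.ne', hp'.ne']
    rw [Real.norm_of_nonneg (by norm_num)]; linarith
  · rw [inner_smul_left, inner_add_left, inner_smul_left, inner_smul_left, real_inner_self_eq_norm_sq,
      real_inner_comm]
    simp only [conj_trivial]
    have : 0 < (‖w‖ * ‖w'‖ + inner ℝ w w') / (2 * ‖w'‖) := by
      apply div_pos _ (by positivity); linarith
    convert this using 1
    field_simp
  · rw [inner_smul_left, inner_add_left, inner_smul_left, inner_smul_left, real_inner_self_eq_norm_sq]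
    simp only [conj_trivial]
    have : 0 < (‖w‖ * ‖w'‖ + inner ℝ w w') / (2 * ‖w‖) := by
      apply div_pos _ (by positivity); linarith
    convert this using 1
    field_simp
    ring

theorem forall_vert_of_finite {p : Fin n → ℤ → ℝ → Prop}
    (hp : ∀ i k c, p i (k + P.m i) c ↔ p i k c)
    (h : ∀ i k, ∀ᶠ c in nhdsWithin (0 : ℝ) (Ioi 0), p i k c) :
    ∀ᶠ c in nhdsWithin (0 : ℝ) (Ioi 0), ∀ i k, p i k c := by
  have h1 : ∀ᶠ c in nhdsWithin (0 : ℝ) (Ioi 0), ∀ i, ∀ k : Fin (P.m i), p i (k : ℕ) c :=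
    Filter.eventually_all.2 fun i => Filter.eventually_all.2 fun k => h i _
  filter_upwards [h1] with c hc i k
  have hper : Function.Periodic (fun k => p i k c) (P.m i : ℤ) := fun k => propext (hp i k c)
  have hm : (0 : ℤ) < P.m i := by exact_mod_cast P.m_pos i
  have e : p i k c = p i (k % P.m i) c := by
    have := hper.sub_zsmul_eq (x := k) (k / P.m i)
    simp only [smul_eq_mul] at this
    rw [← this, Int.emod_def, mul_comm]
  rw [e]
  have := hc i ⟨(k % P.m i).toNat, by
    have := Int.emod_lt_of_pos k hm; have := Int.emod_nonneg k hm.ne'; omega⟩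
  simpa [Int.toNat_of_nonneg (Int.emod_nonneg k hm.ne')] using this

theorem exists_uniform_functional : ∃ c > 0, ∀ i (k : ℤ), ∃ μ : E3, ‖μ‖ ≤ 1 ∧
    c ≤ inner ℝ μ (P.vert i k - P.vert i (k - 1)) ∧
    c ≤ inner ℝ μ (P.vert i (k + 1) - P.vert i k) := by
  have h := P.forall_vert_of_finite (p := fun i k c => ∃ μ : E3, ‖μ‖ ≤ 1 ∧
    c ≤ inner ℝ μ (P.vert i k - P.vert i (k - 1)) ∧
    c ≤ inner ℝ μ (P.vert i (k + 1) - P.vert i k)) ?_ ?_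
  · obtain ⟨c, hc, hc0⟩ := (h.and self_mem_nhdsWithin).exists
    exact ⟨c, hc0, hc⟩
  · intro i k c
    have e1 := P.vert_add i k
    have e2 := P.vert_add i (k - 1)
    have e3 := P.vert_add i (k + 1)
    rw [show k - 1 + (P.m i : ℤ) = k + P.m i - 1 by ring] at e2
    rw [show k + 1 + (P.m i : ℤ) = k + P.m i + 1 by ring] at e3
    simp only [e1, e2, e3]
  · intro i k
    obtain ⟨μ, h1, h2, h3⟩ := P.exists_vertex_functional i k
    filter_upwards [Ioc_mem_nhdsGT (lt_min h2 h3)] with c hc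
    exact ⟨μ, h1, hc.2.trans (min_le_left _ _), hc.2.trans (min_le_right _ _)⟩

theorem exists_edge_bound : ∃ B > 0, ∀ i k, ‖P.vert i (k + 1) - P.vert i k‖ ≤ B := by
  have h := P.forall_vert_of_finite (p := fun i k c => ‖P.vert i (k + 1) - P.vert i k‖ ≤ c⁻¹) ?_ ?_
  · obtain ⟨c, hc, hc0⟩ := (h.and self_mem_nhdsWithin).exists
    exact ⟨c⁻¹, inv_pos.2 hc0, hc⟩
  · intro i k c
    have e1 := P.vert_add i k
    have e3 := P.vert_add i (k + 1)
    rw [show k + 1 + (P.m i : ℤ) = k + P.m i + 1 by ring] at e3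
    simp only [e1, e3]
  · intro i k
    exact tendsto_inv_nhdsGT_zero.eventually_ge_atTop _

end PolygonalLink

theorem injective_of_near_far {n : ℕ} (per : Fin n → ℝ) (γ₀ γ₁ : Fin n → ℝ → E3)
    (h₁ : ∀ i, Function.Periodic (γ₁ i) (per i)) {W κ ρ : ℝ} (hκ : 0 < κ) (hρ : 0 < ρ)
    (near : ∀ i u v, u ≤ v → v ≤ u + W → ∀ s ∈ Icc (0 : ℝ) 1,
      κ * (v - u) ≤ ‖linHomotopy (γ₀ i) (γ₁ i) s v - linHomotopy (γ₀ i) (γ₁ i) s u‖)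
    (far : ∀ i u j v, Far per W i u j v → 3 * ρ ≤ ‖γ₀ i u - γ₀ j v‖)
    (close : ∀ i u, ‖γ₁ i u - γ₀ i u‖ ≤ ρ) (i j : Fin n) (u v : ℝ) (h : γ₁ i u = γ₁ j v) :
    i = j ∧ ∃ z : ℤ, v = u + z * per i := by
  have near1 : ∀ i u v, u ≤ v → v ≤ u + W → γ₁ i v = γ₁ i u → u = v := by
    intro i u v huv hv h
    have := near i u v huv hv 1 ⟨zero_le_one, le_rfl⟩
    simp only [linHomotopy, one_smul, add_sub_cancel, h, sub_self, norm_zero] at this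
    nlinarith
  by_cases hf : Far per W i u j v
  · exfalso
    have h1 := far i u j v hf
    have h2 := close i u
    have h3 := close j v
    have : γ₀ i u - γ₀ j v = (γ₁ j v - γ₀ j v) - (γ₁ i u - γ₀ i u) := by rw [h]; abel
    rw [this] at h1
    have := norm_sub_le (γ₁ j v - γ₀ j v) (γ₁ i u - γ₀ i u)
    linarith
  · unfold Far at hf
    push Not at hf
    obtain ⟨rfl, z, hz⟩ := hf
    refine ⟨rfl, -z, ?_⟩
    rw [← (h₁ i).int_mul z v] at h
    obtain ⟨hz1, hz2⟩ := abs_le.1 hz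
    push_cast
    rcases le_total u (v + z * per i) with h' | h'
    · linarith [near1 i _ _ h' (by linarith) h.symm]
    · linarith [near1 i _ _ h' (by linarith) h]

open Filter Topology in
theorem eventually_quadratic_ne_zero (A B : ℝ) {C : ℝ} (hC : C ≠ 0) :
    ∀ᶠ ε in 𝓝[>] (0 : ℝ), A + ε * B + ε ^ 2 * C ≠ 0 := by
  by_cases hA : A = 0
  · by_cases hB : B = 0
    · filter_upwards [self_mem_nhdsWithin] with ε hε
      have : ε ≠ 0 := ne_of_gt hε
      simp [hA, hB, hC, this]
    · have hc : Continuous fun ε : ℝ => B + ε * C := by fun_prop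
      have := (hc.continuousAt (x := 0)).eventually_ne (y := 0) (by simpa using hB)
      filter_upwards [self_mem_nhdsWithin, this.filter_mono nhdsWithin_le_nhds] with ε hε h
      have : ε ≠ 0 := ne_of_gt hε
      rw [hA, show 0 + ε * B + ε ^ 2 * C = ε * (B + ε * C) by ring]
      exact mul_ne_zero this h
  · have hc : Continuous fun ε : ℝ => A + ε * B + ε ^ 2 * C := by fun_prop
    exact ((hc.continuousAt (x := 0)).eventually_ne (y := 0) (by simpa using hA)).filter_mono
      nhdsWithin_le_nhds

/-- The coordinates of the cross product of `w` and `w'`. -/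
def minor (w w' : E3) (a b : Fin 3) : ℝ := w a * w' b - w b * w' a

/-- The point with parameter `t` on the moment curve. -/
noncomputable def momentPoint (t : ℝ) : E3 := !₂[t, t ^ 2, t ^ 3]

theorem minor_momentPoint_ne_zero {t₀ t₁ t₂ : ℝ} (h0 : 0 < t₀) (h1 : 0 < t₁) (h2 : 0 < t₂)
    (h01 : t₁ ≠ t₀) (h12 : t₂ ≠ t₁) (h02 : t₂ ≠ t₀) {a b : Fin 3} (hab : a ≠ b) :
    minor (momentPoint t₁ - momentPoint t₀) (momentPoint t₂ - momentPoint t₁) a b ≠ 0 := by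
  have hD : (t₁ - t₀) * (t₂ - t₁) * (t₂ - t₀) ≠ 0 :=
    mul_ne_zero (mul_ne_zero (sub_ne_zero.2 h01) (sub_ne_zero.2 h12)) (sub_ne_zero.2 h02)
  have h3 : t₀ + t₁ + t₂ ≠ 0 := by positivity
  have h4 : t₀ * t₁ + t₀ * t₂ + t₁ * t₂ ≠ 0 := by positivity
  fin_cases a <;> fin_cases b <;> simp [minor, momentPoint] at hab ⊢
  · convert hD using 1; ring_nf
  · convert mul_ne_zero hD h3 using 1; ring_nf
  · convert neg_ne_zero.2 hD using 1; ring_nf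
  · convert mul_ne_zero hD h4 using 1; ring_nf
  · convert neg_ne_zero.2 (mul_ne_zero hD h3) using 1; ring_nf
  · convert neg_ne_zero.2 (mul_ne_zero hD h4) using 1; ring_nf

theorem norm_polyCurve_sub_le {V V' : ℤ → E3} {δ : ℝ} (h : ∀ k, ‖V k - V' k‖ ≤ δ) (x : ℝ) :
    ‖polyCurve V x - polyCurve V' x‖ ≤ δ := by
  have e : polyCurve V x - polyCurve V' x =
      (1 - Int.fract x) • (V ⌊x⌋ - V' ⌊x⌋) + Int.fract x • (V (⌊x⌋ + 1) - V' (⌊x⌋ + 1)) := by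
    simp only [polyCurve]; module
  have h0 := Int.fract_nonneg x
  have h1 := Int.fract_lt_one x
  rw [e]
  calc _ ≤ (1 - Int.fract x) * ‖V ⌊x⌋ - V' ⌊x⌋‖ + Int.fract x * ‖V (⌊x⌋ + 1) - V' (⌊x⌋ + 1)‖ := by
        refine (norm_add_le _ _).trans ?_
        rw [norm_smul, norm_smul, Real.norm_of_nonneg h0, Real.norm_of_nonneg (by linarith)]
    _ ≤ (1 - Int.fract x) * δ + Int.fract x * δ := by
        have : 0 ≤ 1 - Int.fract x := by linarith
        gcongr <;> exact h _
    _ = δ := by ring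

namespace PolygonalLink
variable {n : ℕ} (P : PolygonalLink n)

/-- Vertices on the moment curve, indexed like those of `P`. -/
noncomputable def genericVert (i : Fin n) (k : ℤ) : E3 :=
  momentPoint ((k : ZMod (P.m i)).val + 1)

open Filter Topology in
/-- The vertices can be moved by arbitrarily little so that no coordinate of the cross product of
consecutive edges vanishes. -/
theorem exists_generic_perturbation {δ : ℝ} (hδ : 0 < δ) : ∃ V : Fin n → ℤ → E3,
    (∀ i k, V i (k + P.m i) = V i k) ∧ (∀ i k, ‖V i k - P.vert i k‖ ≤ δ) ∧
    ∀ i k a b, a ≠ b → minor (V i k - V i (k - 1)) (V i (k + 1) - V i k) a b ≠ 0 := by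
  have hG : ∀ i k, P.genericVert i (k + P.m i) = P.genericVert i k := by
    intro i k; simp [genericVert]
  have hGne : ∀ i k a b, a ≠ b → minor (P.genericVert i k - P.genericVert i (k - 1))
      (P.genericVert i (k + 1) - P.genericVert i k) a b ≠ 0 := by
    intro i k a b hab
    have h3 := P.three_le i
    have hinj : ∀ k l : ℤ, k < l → l < k + 3 →
        ((l : ZMod (P.m i)).val : ℝ) + 1 ≠ (k : ZMod (P.m i)).val + 1 := by
      intro k l h h' heq
      have : NeZero (P.m i) := ⟨by omega⟩
      have e : (l : ZMod (P.m i)) = k := ZMod.val_injective _ (by exact_mod_cast add_right_cancel heq)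
      rw [ZMod.intCast_eq_intCast_iff_dvd_sub] at e
      have := Int.le_of_dvd (by omega) ((dvd_neg).2 e)
      omega
    exact minor_momentPoint_ne_zero (by positivity) (by positivity) (by positivity)
      (hinj _ _ (by omega) (by omega)) (hinj _ _ (by omega) (by omega))
      (hinj _ _ (by omega) (by omega)) hab
  have e1 : ∀ᶠ ε in 𝓝[>] (0 : ℝ), ∀ i k, ‖ε • P.genericVert i k‖ ≤ δ := by
    refine P.forall_vert_of_finite (fun i k c => by rw [hG]) fun i k => ?_
    have hc : Continuous fun ε : ℝ => ‖ε • P.genericVert i k‖ := by fun_prop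
    have := hc.tendsto 0
    rw [zero_smul, norm_zero] at this
    exact (this.eventually_le_const hδ).filter_mono nhdsWithin_le_nhds
  have e2 : ∀ᶠ ε in 𝓝[>] (0 : ℝ), ∀ i k, ∀ a b : Fin 3, a ≠ b →
      minor ((P.vert i k + ε • P.genericVert i k) - (P.vert i (k - 1) + ε • P.genericVert i (k - 1)))
        ((P.vert i (k + 1) + ε • P.genericVert i (k + 1)) - (P.vert i k + ε • P.genericVert i k)) a b
        ≠ 0 := by
    refine P.forall_vert_of_finite (fun i k c => ?_) fun i k => ?_
    · have a1 := hG i (k - 1)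
      have a2 := hG i (k + 1)
      have a3 := P.vert_add i (k - 1)
      have a4 := P.vert_add i (k + 1)
      rw [show k - 1 + (P.m i : ℤ) = k + P.m i - 1 by ring] at a1 a3
      rw [show k + 1 + (P.m i : ℤ) = k + P.m i + 1 by ring] at a2 a4
      simp only [a1, a2, a3, a4, hG, P.vert_add]
    · refine eventually_all.2 fun a => eventually_all.2 fun b => ?_
      by_cases hab : a = b
      · simp [hab]
      filter_upwards [eventually_quadratic_ne_zero
        (minor (P.vert i k - P.vert i (k - 1)) (P.vert i (k + 1) - P.vert i k) a b)
        (minor (P.vert i k - P.vert i (k - 1)) (P.genericVert i (k + 1) - P.genericVert i k) a b +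
        minor (P.genericVert i k - P.genericVert i (k - 1)) (P.vert i (k + 1) - P.vert i k) a b)
        (hGne i k a b hab)] with ε hε _
      convert hε using 1
      simp only [minor, PiLp.sub_apply, PiLp.add_apply, PiLp.smul_apply, smul_eq_mul]
      ring
  obtain ⟨ε, h1, h2⟩ := (e1.and e2).exists
  refine ⟨fun i k => P.vert i k + ε • P.genericVert i k, fun i k => by simp only [hG, P.vert_add],
    fun i k => by simpa using h1 i k, fun i k a b hab => h2 i k a b hab⟩

end PolygonalLink

/-- The moving average of a curve over windows of radius `h`. -/
noncomputable def smoothing (γ : ℝ → E3) (h : ℝ) (u : ℝ) : E3 :=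
  (1 / (2 * h)) • ∫ t in (u - h)..(u + h), γ t

theorem smoothing_periodic {γ : ℝ → E3} {p : ℝ} (hγ : Function.Periodic γ p) (h : ℝ) :
    Function.Periodic (smoothing γ h) p := by
  intro u
  have := intervalIntegral.integral_comp_add_right (a := u - h) (b := u + h) γ p
  simp only [hγ _] at this
  rw [smoothing, smoothing, this]
  ring_nf

theorem hasDerivAt_smoothing {γ : ℝ → E3} (hγ : Continuous γ) (h u : ℝ) :
    HasDerivAt (smoothing γ h) ((1 / (2 * h)) • (γ (u + h) - γ (u - h))) u := by
  have e : smoothing γ h = fun u => (1 / (2 * h)) •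
      ((∫ t in (0 : ℝ)..(u + h), γ t) - ∫ t in (0 : ℝ)..(u - h), γ t) := by
    ext1 u
    rw [smoothing, intervalIntegral.integral_interval_sub_left (hγ.intervalIntegrable _ _)
      (hγ.intervalIntegrable _ _)]
  have hI : ∀ x, HasDerivAt (fun u => ∫ t in (0 : ℝ)..u, γ t) (γ x) x := fun x =>
    intervalIntegral.integral_hasDerivAt_right (hγ.intervalIntegrable _ _)
      (hγ.stronglyMeasurableAtFilter _ _) hγ.continuousAt
  rw [e]
  exact (((hI (u + h)).comp_add_const u h).sub ((hI (u - h)).comp_sub_const u h)).const_smul (1 / (2 * h))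

theorem norm_smoothing_sub_le {γ : ℝ → E3} (hγ : Continuous γ) {h C : ℝ} (hh : 0 < h) (u : ℝ)
    (hC : ∀ t, |t - u| ≤ h → ‖γ t - γ u‖ ≤ C) : ‖smoothing γ h u - γ u‖ ≤ C := by
  have e : smoothing γ h u - γ u = (1 / (2 * h)) • ∫ t in (u - h)..(u + h), (γ t - γ u) := by
    rw [intervalIntegral.integral_sub (hγ.intervalIntegrable _ _) intervalIntegrable_const,
      intervalIntegral.integral_const, smul_sub, smul_smul, smoothing]
    congr 1
    rw [show 1 / (2 * h) * (u + h - (u - h)) = 1 by field_simp; ring, one_smul]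
  have := intervalIntegral.norm_integral_le_of_norm_le_const (a := u - h) (b := u + h) (C := C)
    (f := fun t => γ t - γ u) (by
      intro t ht
      rw [uIoc_of_le (by linarith)] at ht
      exact hC t (abs_le.2 ⟨by linarith [ht.1], by linarith [ht.2]⟩))
  rw [e, norm_smul, Real.norm_of_nonneg (by positivity)]
  rw [show u + h - (u - h) = 2 * h by ring, abs_of_pos (by positivity)] at this
  calc _ ≤ 1 / (2 * h) * (C * (2 * h)) := by gcongr
    _ = C := by field_simp

theorem norm_polyCurve_smoothing_sub {V : ℤ → E3} {B h : ℝ} (hB : ∀ k, ‖V (k + 1) - V k‖ ≤ B)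
    (hh : 0 < h) (h1 : h ≤ 1) (u : ℝ) :
    ‖smoothing (polyCurve V) h u - polyCurve V u‖ ≤ B * h := by
  have hB0 : 0 ≤ B := (norm_nonneg _).trans (hB 0)
  refine norm_smoothing_sub_le (continuous_of_lip_near fun x y => polyCurve_lip hB) hh u ?_
  intro t ht
  obtain ⟨ht1, ht2⟩ := abs_le.1 ht
  rcases le_total u t with hut | hut
  · exact (polyCurve_lip hB hut (by linarith)).trans (by gcongr)
  · rw [norm_sub_rev]
    exact (polyCurve_lip hB hut (by linarith)).trans (by gcongr; linarith)

/-- A closed `C¹` curve family obtained from a polygonal link: at most one coordinate of its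
velocity vanishes at a time. -/
theorem PolygonalLink.exists_generic_curve {n : ℕ} (P : PolygonalLink n) :
    ∃ Q Q' : Fin n → ℝ → E3, (∀ i, Function.Periodic (Q i) (P.m i)) ∧
      (∀ i, Function.Periodic (Q' i) (P.m i)) ∧ (∀ i u, HasDerivAt (Q i) (Q' i u) u) ∧
      (∀ i, Continuous (Q' i)) ∧ (∃ Λ, ∀ i u, ‖Q' i u‖ ≤ Λ) ∧
      (∀ i u a b, a ≠ b → Q' i u a ≠ 0 ∨ Q' i u b ≠ 0) ∧
      (∀ i j u v, Q i u = Q j v → i = j ∧ ∃ z : ℤ, v = u + z * (P.m i : ℝ)) ∧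
      AmbientIsotopic P.carrier (carrierOf Q) := by
  obtain ⟨c, hc, hμ⟩ := P.exists_uniform_functional
  obtain ⟨B, hB0, hB⟩ := P.exists_edge_bound
  have hper0 : ∀ i, Function.Periodic (polyCurve (P.vert i)) (P.m i : ℝ) := fun i => by
    exact_mod_cast polyCurve_periodic (P.vert_add i)
  obtain ⟨ρ, hρ, hfar⟩ := exists_far_bound (fun i => (P.m i : ℝ))
    (fun i => by exact_mod_cast P.m_pos i) (fun i => polyCurve (P.vert i))
    (fun i => continuous_of_lip_near fun x y => polyCurve_lip (hB i)) hper0 P.polyCurve_inj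
    (W := 1 / 2) (by norm_num)
  set δ := min (c / 4) (ρ / 6) with hδ
  have hδ0 : 0 < δ := lt_min (by positivity) (by positivity)
  have hδc : δ ≤ c / 4 := min_le_left _ _
  have hδρ : δ ≤ ρ / 6 := min_le_right _ _
  obtain ⟨V, hV, hVδ, hgen⟩ := P.exists_generic_perturbation hδ0
  set B' := B + 2 * δ with hB'
  have hB'0 : 0 < B' := by positivity
  have hVB : ∀ i k, ‖V i (k + 1) - V i k‖ ≤ B' := by
    intro i k
    have e : V i (k + 1) - V i k = (P.vert i (k + 1) - P.vert i k) +
        ((V i (k + 1) - P.vert i (k + 1)) - (V i k - P.vert i k)) := by abel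
    rw [e]
    refine (norm_add_le _ _).trans ?_
    have := norm_sub_le (V i (k + 1) - P.vert i (k + 1)) (V i k - P.vert i k)
    linarith [hB i k, hVδ i k, hVδ i (k + 1)]
  set h := min (1 / 8) (ρ / (6 * B')) with hh
  have hh0 : 0 < h := lt_min (by norm_num) (by positivity)
  have hh8 : h ≤ 1 / 8 := min_le_left _ _
  have hhρ : B' * h ≤ ρ / 6 := by
    calc B' * h ≤ B' * (ρ / (6 * B')) := by gcongr; exact min_le_right _ _
      _ = _ := by field_simp
  have hcont : ∀ i, Continuous (polyCurve (V i)) := fun i =>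
    continuous_of_lip_near fun x y => polyCurve_lip (hVB i)
  have hperV : ∀ i, Function.Periodic (polyCurve (V i)) (P.m i : ℝ) := fun i => by
    exact_mod_cast polyCurve_periodic (hV i)
  let Q : Fin n → ℝ → E3 := fun i => smoothing (polyCurve (V i)) h
  let Q' : Fin n → ℝ → E3 := fun i u =>
    (1 / (2 * h)) • (polyCurve (V i) (u + h) - polyCurve (V i) (u - h))
  have hQ : ∀ i u, HasDerivAt (Q i) (Q' i u) u := fun i u => hasDerivAt_smoothing (hcont i) h u
  have hQper : ∀ i, Function.Periodic (Q i) (P.m i) := fun i => smoothing_periodic (hperV i) h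
  have hμ' : ∀ i k, ∃ μ : E3, ‖μ‖ ≤ 1 ∧
      c ≤ inner ℝ μ (P.vert i k - P.vert i (k - 1)) ∧
      c ≤ inner ℝ μ (P.vert i (k + 1) - P.vert i k) ∧
      c / 2 ≤ inner ℝ μ (V i k - V i (k - 1)) ∧ c / 2 ≤ inner ℝ μ (V i (k + 1) - V i k) := by
    intro i k
    obtain ⟨μ, h1, h2, h3⟩ := hμ i k
    have e : ∀ k l, -(2 * δ) ≤ inner ℝ μ ((V i l - P.vert i l) - (V i k - P.vert i k)) := by
      intro k l
      refine neg_le_of_abs_le ((abs_real_inner_le_norm _ _).trans ?_)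
      have := norm_sub_le (V i l - P.vert i l) (V i k - P.vert i k)
      have : ‖(V i l - P.vert i l) - (V i k - P.vert i k)‖ ≤ 2 * δ := by
        linarith [hVδ i l, hVδ i k]
      nlinarith [norm_nonneg μ, norm_nonneg ((V i l - P.vert i l) - (V i k - P.vert i k))]
    refine ⟨μ, h1, h2, h3, ?_, ?_⟩
    · have := e (k - 1) k
      rw [sub_sub_sub_comm, inner_sub_right] at this
      linarith
    · have := e k (k + 1)
      rw [sub_sub_sub_comm, inner_sub_right] at this
      linarith
  have near : ∀ i u v, u ≤ v → v ≤ u + 1 / 2 → ∀ s ∈ Icc (0 : ℝ) 1,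
      c / 2 * (v - u) ≤ ‖linHomotopy (polyCurve (P.vert i)) (Q i) s v -
        linHomotopy (polyCurve (P.vert i)) (Q i) s u‖ := by
    intro i u v huv hv s hs
    set k := ⌊v + h⌋
    have hk1 := Int.floor_le (v + h)
    have hk2 := Int.lt_floor_add_one (v + h)
    obtain ⟨μ, h1, h2, h3, h4, h5⟩ := hμ' i k
    have m0 : c / 2 * (v - u) ≤ inner ℝ μ (polyCurve (P.vert i) v - polyCurve (P.vert i) u) := by
      obtain ⟨a, b, ha, hb, hab, e⟩ := polyCurve_sub (V := P.vert i) (k := k) (x := u) (y := v)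
        (by linarith) huv (by linarith)
      rw [e, inner_add_right, inner_smul_right, inner_smul_right, ← hab]
      nlinarith
    have m1 : c / 2 * (v - u) ≤ inner ℝ μ (Q i v - Q i u) := by
      have hd : ∀ x, HasDerivAt (fun x => inner ℝ μ (Q i x)) (inner ℝ μ (Q' i x)) x := fun x => by
        simpa using (hasDerivAt_const x μ).inner ℝ (hQ i x)
      rw [inner_sub_right]
      refine (convex_Icc u v).mul_sub_le_image_sub_of_le_deriv
        (f := fun x => inner ℝ μ (Q i x)) (fun x _ => (hd x).continuousAt.continuousWithinAt)
        (fun x _ => (hd x).differentiableAt.differentiableWithinAt) ?_ u ⟨le_rfl, huv⟩ v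
        ⟨huv, le_rfl⟩ huv
      intro x hx
      rw [interior_Icc] at hx
      rw [(hd x).deriv]
      obtain ⟨a, b, ha, hb, hab, e⟩ := polyCurve_sub (V := V i) (k := k) (x := x - h) (y := x + h)
        (by linarith [hx.1]) (by linarith) (by linarith [hx.2])
      simp only [Q', e, inner_smul_right, inner_add_right]
      rw [show x + h - (x - h) = 2 * h by ring] at hab
      have : c / 2 * (2 * h) ≤ a * inner ℝ μ (V i k - V i (k - 1)) +
          b * inner ℝ μ (V i (k + 1) - V i k) := by rw [← hab]; nlinarith
      calc c / 2 = 1 / (2 * h) * (c / 2 * (2 * h)) := by field_simp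
        _ ≤ _ := by gcongr
    have e : linHomotopy (polyCurve (P.vert i)) (Q i) s v -
        linHomotopy (polyCurve (P.vert i)) (Q i) s u =
        (1 - s) • (polyCurve (P.vert i) v - polyCurve (P.vert i) u) + s • (Q i v - Q i u) := by
      simp only [linHomotopy]; module
    have m2 : c / 2 * (v - u) ≤ inner ℝ μ (linHomotopy (polyCurve (P.vert i)) (Q i) s v -
        linHomotopy (polyCurve (P.vert i)) (Q i) s u) := by
      rw [e, inner_add_right, inner_smul_right, inner_smul_right]
      have a1 := mul_le_mul_of_nonneg_left m0 (sub_nonneg.2 hs.2)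
      have a2 := mul_le_mul_of_nonneg_left m1 hs.1
      linarith
    refine m2.trans ((real_inner_le_norm _ _).trans ?_)
    exact mul_le_of_le_one_left (norm_nonneg _) h1
  have hΛ : ∀ i u, ‖Q' i u‖ ≤ B' := by
    intro i u
    have := polyCurve_lip (hVB i) (x := u - h) (y := u + h) (by linarith) (by linarith)
    simp only [Q', norm_smul]
    rw [Real.norm_of_nonneg (by positivity)]
    calc _ ≤ 1 / (2 * h) * (B' * (u + h - (u - h))) := by gcongr
      _ = B' := by field_simp; ring
  have lipQ : ∀ i u v, ‖Q i v - Q i u‖ ≤ B' * ‖v - u‖ := fun i u v =>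
    convex_univ.norm_image_sub_le_of_norm_hasDerivWithin_le
      (fun x _ => (hQ i x).hasDerivWithinAt) (fun x _ => hΛ i x) (mem_univ u) (mem_univ v)
  have lip : ∀ i u v, u ≤ v → v ≤ u + 1 / 2 →
      ‖(Q i v - polyCurve (P.vert i) v) - (Q i u - polyCurve (P.vert i) u)‖ ≤
        (B' + B) * (v - u) := by
    intro i u v huv hv
    rw [sub_sub_sub_comm]
    refine (norm_sub_le _ _).trans ?_
    have a1 := lipQ i u v
    rw [Real.norm_of_nonneg (by linarith)] at a1
    have a2 := polyCurve_lip (hB i) huv (by linarith)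
    linarith
  have far : ∀ i u j v, Far (fun i => (P.m i : ℝ)) (1 / 2) i u j v →
      3 * (ρ / 3) ≤ ‖polyCurve (P.vert i) u - polyCurve (P.vert j) v‖ := by
    intro i u j v hf
    have := hfar i u j v hf
    linarith
  have close : ∀ i u, ‖Q i u - polyCurve (P.vert i) u‖ ≤ ρ / 3 := by
    intro i u
    have a1 := norm_polyCurve_smoothing_sub (hVB i) hh0 (by linarith) u
    have a2 := norm_polyCurve_sub_le (hVδ i) u
    have := norm_sub_le_norm_sub_add_norm_sub (Q i u) (polyCurve (V i) u) (polyCurve (P.vert i) u)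
    linarith
  refine ⟨Q, Q', hQper, ?_, hQ, ?_, ⟨B', hΛ⟩, ?_, ?_, ?_⟩
  · intro i u
    have a1 := hperV i (u + h)
    have a2 := hperV i (u - h)
    simp only [Q']
    rw [← a1, ← a2]
    ring_nf
  · intro i
    have := hcont i
    fun_prop
  · intro i u a b hab
    by_contra! hcon
    obtain ⟨h1, h2⟩ := hcon
    have hk1 := Int.floor_le (u + h)
    have hk2 := Int.lt_floor_add_one (u + h)
    obtain ⟨x, y, hx, hy, hxy, e⟩ := polyCurve_sub (V := V i) (k := ⌊u + h⌋) (x := u - h)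
      (y := u + h) (by linarith) (by linarith) (by linarith)
    have hg := hgen i ⌊u + h⌋ a b hab
    have hne : (1 / (2 * h)) ≠ 0 := by positivity
    simp only [Q', e, PiLp.smul_apply, PiLp.add_apply, smul_eq_mul, mul_eq_zero, hne, false_or]
      at h1 h2
    apply hg
    have hz : (x + y) * minor (V i ⌊u + h⌋ - V i (⌊u + h⌋ - 1))
        (V i (⌊u + h⌋ + 1) - V i ⌊u + h⌋) a b = 0 := by
      simp only [minor]
      linear_combination ((V i (⌊u + h⌋ + 1) - V i ⌊u + h⌋) b - (V i ⌊u + h⌋ - V i (⌊u + h⌋ - 1)) b) * h1 +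
        ((V i ⌊u + h⌋ - V i (⌊u + h⌋ - 1)) a - (V i (⌊u + h⌋ + 1) - V i ⌊u + h⌋) a) * h2
    rcases mul_eq_zero.1 hz with h | h
    · exfalso; linarith
    · exact h
  · exact injective_of_near_far (fun i => (P.m i : ℝ)) _ Q hQper (by positivity) (by positivity)
      near far close
  · rw [P.carrier_eq]
    exact ambientIsotopic_of_near_far _ _ Q hper0 hQper (by positivity) (by positivity) near lip far
      close

/-- Uniform version of the genericity of the velocity: on every window of length `η`, all but one of
the coordinates are strictly monotone. -/
theorem exists_uniform_windows {n : ℕ} {per : Fin n → ℝ} (hper : ∀ i, 0 < per i)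
    {Q Q' : Fin n → ℝ → E3} (hp : ∀ i, Function.Periodic (Q' i) (per i))
    (hQ : ∀ i u, HasDerivAt (Q i) (Q' i u) u) (hc : ∀ i, Continuous (Q' i))
    (hgen : ∀ i u a b, a ≠ b → Q' i u a ≠ 0 ∨ Q' i u b ≠ 0) :
    ∃ c > 0, ∃ η > 0, ∀ i u, ∃ (bad : Fin 3) (σ : Fin 3 → ℤ), (∀ a, σ a = 1 ∨ σ a = -1) ∧
      ∀ v w, u ≤ v → v ≤ w → w ≤ u + η → ∀ a ≠ bad,
        c * (w - v) ≤ σ a * (Q i w a - Q i v a) := by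
  have key : ∀ i, ∀ᶠ c in nhdsWithin (0 : ℝ) (Ioi 0), ∀ u, ∃ bad : Fin 3, ∃ σ : Fin 3 → ℤ,
      (∀ a, σ a = 1 ∨ σ a = -1) ∧ ∀ v, u ≤ v → v ≤ u + c → ∀ a ≠ bad, c ≤ σ a * Q' i v a := by
    intro i
    have hK : IsCompact (Icc 0 (per i + 1)) := isCompact_Icc
    have hab : ∀ a b, a ≠ b → ∃ c > 0, ∀ u ∈ Icc 0 (per i + 1), c ≤ max |Q' i u a| |Q' i u b| := by
      intro a b hab
      have hcont : Continuous fun u => max |Q' i u a| |Q' i u b| := by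
        have := hc i; fun_prop
      obtain ⟨u, hu, hmin⟩ := hK.exists_isMinOn ⟨0, by simp; linarith [hper i]⟩ hcont.continuousOn
      refine ⟨_, ?_, fun v hv => hmin hv⟩
      rcases hgen i u a b hab with h | h
      · exact lt_max_of_lt_left (abs_pos.2 h)
      · exact lt_max_of_lt_right (abs_pos.2 h)
    obtain ⟨c, hc0, hcb⟩ : ∃ c > 0, ∀ a b, a ≠ b → ∀ u ∈ Icc 0 (per i + 1),
        c ≤ max |Q' i u a| |Q' i u b| := by
      have : ∀ᶠ c in nhdsWithin (0 : ℝ) (Ioi 0), ∀ a b, a ≠ b → ∀ u ∈ Icc 0 (per i + 1),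
          c ≤ max |Q' i u a| |Q' i u b| := by
        refine Filter.eventually_all.2 fun a => Filter.eventually_all.2 fun b => ?_
        by_cases h : a = b
        · simp [h]
        obtain ⟨c, hc0, hcb⟩ := hab a b h
        filter_upwards [Ioc_mem_nhdsGT hc0] with d hd _ u hu
        exact hd.2.trans (hcb u hu)
      obtain ⟨c, h1, h2⟩ := (this.and self_mem_nhdsWithin).exists
      exact ⟨c, h2, h1⟩
    have huc := hK.uniformContinuousOn_of_continuous (hc i).continuousOn
    rw [Metric.uniformContinuousOn_iff] at huc
    obtain ⟨δ, hδ, hu⟩ := huc (c / 2) (by positivity)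
    have hm : 0 < min (c / 2) (min (δ / 2) 1) := by positivity
    filter_upwards [Ioc_mem_nhdsGT hm] with d hd u
    have d1 : d ≤ c / 2 := hd.2.trans (min_le_left _ _)
    have d2 : d ≤ δ / 2 := hd.2.trans ((min_le_right _ _).trans (min_le_left _ _))
    have d3 : d ≤ 1 := hd.2.trans ((min_le_right _ _).trans (min_le_right _ _))
    set u' := toIcoMod (hper i) 0 u with hu'
    have hmem : u' ∈ Ico 0 (0 + per i) := toIcoMod_mem_Ico (hper i) 0 u
    rw [zero_add] at hmem
    have hred : ∀ v, Q' i v = Q' i (v - u + u') := by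
      intro v
      rw [← (hp i).sub_int_mul_eq (toIcoDiv (hper i) 0 u), hu', toIcoMod, zsmul_eq_mul]
      ring_nf
    have huK : u' ∈ Icc 0 (per i + 1) := ⟨hmem.1, by linarith [hmem.2]⟩
    have hex : ∃ bad : Fin 3, ∀ a ≠ bad, c ≤ |Q' i u' a| := by
      by_cases h : ∃ b, |Q' i u' b| < c
      · obtain ⟨b, hb⟩ := h
        refine ⟨b, fun a hab => ?_⟩
        rcases le_max_iff.1 (hcb a b hab u' huK) with h | h
        · exact h
        · linarith
      · push Not at h
        exact ⟨0, fun a _ => h a⟩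
    obtain ⟨bad, hbad⟩ := hex
    refine ⟨bad, fun a => if 0 ≤ Q' i u' a then 1 else -1, fun a => by
      beta_reduce; split_ifs <;> simp, ?_⟩
    intro v huv hv a ha
    have hdist := hu u' huK (v - u + u') ⟨by linarith [hmem.1], by linarith [hmem.2]⟩
      (by rw [Real.dist_eq, abs_lt]; constructor <;> linarith)
    rw [hred v]
    rw [dist_eq_norm] at hdist
    have hcoord := (PiLp.norm_apply_le (Q' i u' - Q' i (v - u + u')) a).trans_lt hdist
    rw [PiLp.sub_apply, Real.norm_eq_abs, abs_lt] at hcoord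
    have hba := hbad a ha
    beta_reduce
    split_ifs with h0
    · rw [abs_of_nonneg h0] at hba
      push_cast; linarith
    · rw [abs_of_neg (not_le.1 h0)] at hba
      push_cast; linarith
  obtain ⟨c, h, hc0⟩ := ((Filter.eventually_all.2 key).and self_mem_nhdsWithin).exists
  refine ⟨c, hc0, c, hc0, fun i u => ?_⟩
  obtain ⟨bad, σ, hσ, hb⟩ := h i u
  refine ⟨bad, σ, hσ, fun v w huv hvw hw a ha => ?_⟩
  have hd : ∀ x, HasDerivAt (fun x => (σ a : ℝ) * Q i x a) (σ a * Q' i x a) x := fun x =>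
    ((hasDerivAt_pi.1 ((EuclideanSpace.equiv (Fin 3) ℝ).hasFDerivAt.comp_hasDerivAt x
      (hQ i x))) a).const_mul _
  rw [mul_sub (σ a : ℝ)]
  refine (convex_Icc v w).mul_sub_le_image_sub_of_le_deriv
    (f := fun x => (σ a : ℝ) * Q i x a) (fun x _ => (hd x).continuousAt.continuousWithinAt)
    (fun x _ => (hd x).differentiableAt.differentiableWithinAt) ?_ v ⟨le_rfl, hvw⟩ w
    ⟨hvw, le_rfl⟩ hvw
  intro x hx
  rw [interior_Icc] at hx
  rw [(hd x).deriv]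
  exact hb x (by linarith [hx.1]) (by linarith [hx.2]) a ha

/-- The coordinate axis of the `j`-th run; the axes are used cyclically. -/
def ax (j : ℤ) : Fin 3 := ((j : ZMod 3) : ZMod 3)

theorem ax_eq_iff {i j : ℤ} : ax i = ax j ↔ (3 : ℤ) ∣ j - i :=
  ZMod.intCast_eq_intCast_iff_dvd_sub i j 3

theorem ax_ne {i j : ℤ} (h : i < j) (h' : j < i + 3) : ax i ≠ ax j := by
  rw [Ne, ax_eq_iff]; omega

theorem ax_cases (j : ℤ) (a : Fin 3) : a = ax j ∨ a = ax (j - 1) ∨ a = ax (j - 2) := by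
  have h1 := ax_ne (show j - 1 < j by omega) (by omega)
  have h2 := ax_ne (show j - 2 < j by omega) (by omega)
  have h3 := ax_ne (show j - 2 < j - 1 by omega) (by omega)
  generalize ax j = p at *
  generalize ax (j - 1) = q at *
  generalize ax (j - 2) = r at *
  revert a p q r
  decide

/-- The vector with coordinates `A`, `B`, `C` along the axes of the runs `j`, `j - 1`, `j - 2`. -/
noncomputable def tri (j : ℤ) (A B C : ℝ) : E3 :=
  WithLp.toLp 2 fun a => if a = ax j then A else if a = ax (j - 1) then B else C

theorem tri_fst (j : ℤ) (A B C : ℝ) : tri j A B C (ax j) = A := by simp [tri]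

theorem tri_snd (j : ℤ) (A B C : ℝ) : tri j A B C (ax (j - 1)) = B := by
  simp [tri, ax_ne (show j - 1 < j by omega) (by omega)]

theorem tri_trd (j : ℤ) (A B C : ℝ) : tri j A B C (ax (j - 2)) = C := by
  simp [tri, ax_ne (show j - 2 < j by omega) (by omega),
    ax_ne (show j - 2 < j - 1 by omega) (by omega)]

theorem tri_ext {j : ℤ} {v w : E3} (h : v (ax j) = w (ax j))
    (h1 : v (ax (j - 1)) = w (ax (j - 1))) (h2 : v (ax (j - 2)) = w (ax (j - 2))) : v = w := by
  ext a
  rcases ax_cases j a with rfl | rfl | rfl <;> assumption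

theorem tri_eta (j : ℤ) (v : E3) : v = tri j (v (ax j)) (v (ax (j - 1))) (v (ax (j - 2))) :=
  tri_ext (j := j) (tri_fst ..).symm (tri_snd ..).symm (tri_trd ..).symm

theorem ax_succ (j : ℤ) : ax (j + 1) = ax (j - 2) := by rw [ax_eq_iff]; omega

theorem tri_succ (j : ℤ) (A B C : ℝ) : tri (j + 1) A B C = tri j B C A := by
  apply tri_ext (j := j)
  · have := tri_snd (j + 1) A B C
    rw [add_sub_cancel_right] at this; rw [this, tri_fst]
  · have := tri_trd (j + 1) A B C
    rw [show j + 1 - 2 = j - 1 by ring] at this; rw [this, tri_snd]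
  · rw [← ax_succ, tri_fst, ax_succ, tri_trd]

theorem tri_congr_ax {i j : ℤ} (h : (3 : ℤ) ∣ j - i) (A B C : ℝ) : tri i A B C = tri j A B C := by
  have e0 : ax i = ax j := ax_eq_iff.2 h
  have e1 : ax (i - 1) = ax (j - 1) := ax_eq_iff.2 (by omega)
  simp [tri, e0, e1]

theorem tri_sub (j : ℤ) (A B C A' B' C' : ℝ) :
    tri j A B C - tri j A' B' C' = tri j (A - A') (B - B') (C - C') := by
  apply tri_ext (j := j) <;> simp [tri_fst, tri_snd, tri_trd]

theorem tri_add (j : ℤ) (A B C A' B' C' : ℝ) :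
    tri j A B C + tri j A' B' C' = tri j (A + A') (B + B') (C + C') := by
  apply tri_ext (j := j) <;> simp [tri_fst, tri_snd, tri_trd]

theorem tri_smul (j : ℤ) (A B C r : ℝ) : r • tri j A B C = tri j (r * A) (r * B) (r * C) := by
  apply tri_ext (j := j) <;> simp [tri_fst, tri_snd, tri_trd]

theorem norm_sq_tri (j : ℤ) (A B C : ℝ) : ‖tri j A B C‖ ^ 2 = A ^ 2 + B ^ 2 + C ^ 2 := by
  have h1 := ax_ne (show j - 1 < j by omega) (by omega)
  have h2 := ax_ne (show j - 2 < j by omega) (by omega)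
  have h3 := ax_ne (show j - 2 < j - 1 by omega) (by omega)
  have hu : (Finset.univ : Finset (Fin 3)) = {ax j, ax (j - 1), ax (j - 2)} := by
    ext a; simpa using ax_cases j a
  rw [EuclideanSpace.norm_sq_eq, hu, Finset.sum_insert (by simp [h1.symm, h2.symm]),
    Finset.sum_insert (by simp [h3.symm]), Finset.sum_singleton, tri_fst, tri_snd, tri_trd]
  simp only [Real.norm_eq_abs, sq_abs]
  ring

theorem norm_tri_le (j : ℤ) (A B C : ℝ) : ‖tri j A B C‖ ≤ |A| + |B| + |C| := by
  refine le_of_sq_le_sq ?_ (by positivity)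
  rw [norm_sq_tri, ← sq_abs A, ← sq_abs B, ← sq_abs C]
  nlinarith [abs_nonneg A, abs_nonneg B, abs_nonneg C, mul_nonneg (abs_nonneg A) (abs_nonneg B),
    mul_nonneg (abs_nonneg A) (abs_nonneg C), mul_nonneg (abs_nonneg B) (abs_nonneg C)]

theorem abs_coord_le (v : E3) (a : Fin 3) : |v a| ≤ ‖v‖ := PiLp.norm_apply_le v a

/-- The sign `(-1) ^ j`. -/
def tau (j : ℤ) : ℤ := if Even j then 1 else -1

theorem tau_succ (j : ℤ) : tau (j + 1) = -tau j := by
  by_cases h : Even j <;> simp [tau, h]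

theorem tau_mul_self (j : ℤ) : tau j * tau j = 1 := by
  by_cases h : Even j <;> simp [tau, h]

theorem abs_tau (j : ℤ) : |(tau j : ℝ)| = 1 := by
  by_cases h : Even j <;> simp [tau, h]

/-- Combinatorial data of a closed lattice polygon whose edges, the runs, use the three axes
cyclically, and around which helices of alternating handedness can be wound. The run `j` changes
the coordinate along the axis `ax j` from `x (j - 3)` to `x j`. -/
structure RunData where
  x : ℤ → ℤ
  s : ℤ → ℤ
  J : ℤ
  J_pos : 0 < J
  six_dvd : 6 ∣ J
  x_add : ∀ j, x (j + J) = x j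
  s_add : ∀ j, s (j + J) = s j
  s_eq : ∀ j, s j = 1 ∨ s j = -1
  seven_le : ∀ j, 7 ≤ s j * (x j - x (j - 3))
  torsion : ∀ j, 4 ∣ s j * (x j - x (j - 3)) - tau j * s (j - 1) * s j * s (j + 1)

namespace RunData
variable (D : RunData)

/-- The number of quarter turns of the helix along the run `j`. -/
def len (j : ℤ) : ℤ := D.s j * (D.x j - D.x (j - 3))

theorem s_mul_self (j : ℤ) : D.s j * D.s j = 1 := by rcases D.s_eq j with h | h <;> simp [h]

theorem s_mul_self' (j : ℤ) : (D.s j : ℝ) * D.s j = 1 := by exact_mod_cast D.s_mul_self j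

theorem s_mul_len (j : ℤ) : (D.s j : ℝ) * D.len j = D.x j - D.x (j - 3) := by
  rw [len]; push_cast; rw [← mul_assoc, D.s_mul_self', one_mul]

theorem abs_s (j : ℤ) : |(D.s j : ℝ)| = 1 := by rcases D.s_eq j with h | h <;> simp [h]

theorem seven_le_len (j : ℤ) : (7 : ℝ) ≤ D.len j := by exact_mod_cast D.seven_le j

theorem len_add (j : ℤ) : D.len (j + D.J) = D.len j := by
  rw [len, len, D.s_add, D.x_add, show j + D.J - 3 = j - 3 + D.J by ring, D.x_add]

theorem sin_len (j : ℤ) : Real.sin (D.len j * (Real.pi / 2)) =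
      tau j * D.s (j - 1) * D.s j * D.s (j + 1) ∧ Real.cos (D.len j * (Real.pi / 2)) = 0 := by
  obtain ⟨z, hz⟩ := D.torsion j
  have h1 : tau j * D.s (j - 1) * D.s j * D.s (j + 1) = 1 ∨
      tau j * D.s (j - 1) * D.s j * D.s (j + 1) = -1 := by
    rcases D.s_eq (j - 1) with h | h <;> rcases D.s_eq j with h' | h' <;>
    rcases D.s_eq (j + 1) with h'' | h'' <;> by_cases h4 : Even j <;> simp [h, h', h'', tau, h4]
  have h2 : D.len j = tau j * D.s (j - 1) * D.s j * D.s (j + 1) + 4 * z := by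
    rw [len]; linarith
  have h3 : ((tau j : ℝ) * D.s (j - 1) * D.s j * D.s (j + 1)) =
    ((tau j * D.s (j - 1) * D.s j * D.s (j + 1) : ℤ) : ℝ) := by push_cast; ring
  rw [h3, h2]
  rcases h1 with h | h <;> rw [h] <;> push_cast
  · rw [show ((1 : ℝ) + 4 * z) * (Real.pi / 2) = Real.pi / 2 + z * (2 * Real.pi) by ring,
      Real.sin_add_int_mul_two_pi, Real.cos_add_int_mul_two_pi]
    simp
  · rw [show ((-1 : ℝ) + 4 * z) * (Real.pi / 2) = -(Real.pi / 2) + z * (2 * Real.pi) by ring,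
      Real.sin_add_int_mul_two_pi, Real.cos_add_int_mul_two_pi]
    simp

/-- The helix of radius `r` around the run `j`, at the angle `α` after its start. -/
noncomputable def helix (r : ℝ) (j : ℤ) (α : ℝ) : E3 :=
  tri j (Real.pi / 4 * D.x (j - 3) + D.s j * α / 2)
    (Real.pi / 4 * D.x (j - 1) + r * (D.s (j - 1) * Real.sin α))
    (Real.pi / 4 * D.x (j - 2) - r * (tau j * D.s (j - 1) * D.s j * Real.cos α))

/-- The closed curve made of helices of radius `r`, parametrized so that each run takes unit
time. -/
noncomputable def curve (r u : ℝ) : E3 :=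
  D.helix r ⌊u⌋ (Int.fract u * (D.len ⌊u⌋ * (Real.pi / 2)))

theorem helix_end (r : ℝ) (j : ℤ) :
    D.helix r j (D.len j * (Real.pi / 2)) = D.helix r (j + 1) 0 := by
  obtain ⟨h1, h2⟩ := D.sin_len j
  rw [helix, helix, tri_succ, h1, h2]
  have e := D.s_mul_len j
  rw [show j + 1 - 3 = j - 2 by ring, show j + 1 - 1 = j by ring, show j + 1 - 2 = j - 1 by ring,
    tau_succ]
  have e1 := D.s_mul_self' (j - 1)
  have e2 := D.s_mul_self' j
  congr 1
  · rw [Real.sin_zero]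
    linear_combination (Real.pi / 4) * e
  · rw [Real.cos_zero]; push_cast
    linear_combination (r * tau j * D.s j * D.s (j + 1)) * e1
  · ring

theorem curve_eq (r : ℝ) {j : ℤ} {u : ℝ} (h : (j : ℝ) ≤ u) (h' : u ≤ j + 1) :
    D.curve r u = D.helix r j ((u - j) * (D.len j * (Real.pi / 2))) := by
  rcases h'.lt_or_eq with h' | h'
  · have : ⌊u⌋ = j := Int.floor_eq_iff.2 ⟨h, h'⟩
    simp [curve, Int.fract, this]
  · have : u = ((j + 1 : ℤ) : ℝ) := by push_cast; exact h'
    rw [curve, this, Int.floor_intCast, Int.fract_intCast, zero_mul, ← helix_end]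
    push_cast; ring_nf

theorem tau_add (j : ℤ) : tau (j + D.J) = tau j := by
  obtain ⟨z, hz⟩ := D.six_dvd
  have : Even D.J := ⟨3 * z, by omega⟩
  simp [tau, Int.even_add, this]

theorem helix_add (r : ℝ) (j : ℤ) (α : ℝ) : D.helix r (j + D.J) α = D.helix r j α := by
  have h6 := D.six_dvd
  have e : ∀ c, D.x (j + D.J - c) = D.x (j - c) := fun c => by
    rw [show j + D.J - c = j - c + D.J by ring, D.x_add]
  have e' : ∀ c, D.s (j + D.J - c) = D.s (j - c) := fun c => by
    rw [show j + D.J - c = j - c + D.J by ring, D.s_add]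
  rw [helix, helix, e, e, e, e', D.s_add, D.tau_add, ← tri_congr_ax (i := j)]
  omega

theorem curve_periodic (r : ℝ) : Function.Periodic (D.curve r) D.J := by
  intro u
  simp [curve, helix_add, len_add]

theorem linHomotopy_curve (s u : ℝ) :
    linHomotopy (D.curve 0) (D.curve (1 / 2)) s u = D.curve (s / 2) u := by
  simp only [linHomotopy, curve, helix, tri_sub, tri_smul, tri_add]
  congr 1 <;> ring

theorem abs_helix_sub (r : ℝ) (hr : 0 ≤ r) (j : ℤ) (α : ℝ) (a : Fin 3) :
    |D.helix r j α a - D.helix 0 j α a| ≤ r := by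
  have hs := Real.abs_sin_le_one α
  have hc := Real.abs_cos_le_one α
  rw [← PiLp.sub_apply, helix, helix, tri_sub]
  rcases ax_cases j a with rfl | rfl | rfl
  · rw [tri_fst]; simpa using hr
  · rw [tri_snd]
    rw [show Real.pi / 4 * D.x (j - 1) + r * (D.s (j - 1) * Real.sin α) -
      (Real.pi / 4 * D.x (j - 1) + 0 * (D.s (j - 1) * Real.sin α)) =
      r * (D.s (j - 1) * Real.sin α) by ring]
    rw [abs_mul, abs_mul, D.abs_s, abs_of_nonneg hr, one_mul]
    exact mul_le_of_le_one_right hr hs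
  · rw [tri_trd]
    rw [show Real.pi / 4 * D.x (j - 2) - r * (tau j * D.s (j - 1) * D.s j * Real.cos α) -
      (Real.pi / 4 * D.x (j - 2) - 0 * (tau j * D.s (j - 1) * D.s j * Real.cos α)) =
      -(r * (tau j * D.s (j - 1) * D.s j * Real.cos α)) by ring]
    rw [abs_neg, abs_mul, abs_mul, abs_mul, abs_mul, D.abs_s, D.abs_s, abs_tau, abs_of_nonneg hr,
      one_mul, one_mul, one_mul]
    exact mul_le_of_le_one_right hr hc

theorem norm_curve_half_sub (u : ℝ) : ‖D.curve (1 / 2) u - D.curve 0 u‖ ≤ 1 / 2 := by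
  refine le_of_sq_le_sq ?_ (by positivity)
  rw [curve, curve, helix, helix, tri_sub, norm_sq_tri]
  set α := Int.fract u * (D.len ⌊u⌋ * (Real.pi / 2))
  have e1 := D.s_mul_self' (⌊u⌋ - 1)
  have e2 := D.s_mul_self' ⌊u⌋
  have e3 : (tau ⌊u⌋ : ℝ) * tau ⌊u⌋ = 1 := by exact_mod_cast tau_mul_self ⌊u⌋
  have e4 := Real.sin_sq_add_cos_sq α
  apply le_of_eq
  have e5 : ((tau ⌊u⌋ : ℝ) * D.s (⌊u⌋ - 1) * D.s ⌊u⌋) ^ 2 = 1 := by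
    calc _ = ((tau ⌊u⌋ : ℝ) * tau ⌊u⌋) * ((D.s (⌊u⌋ - 1) : ℝ) * D.s (⌊u⌋ - 1)) *
          ((D.s ⌊u⌋ : ℝ) * D.s ⌊u⌋) := by ring
      _ = 1 := by rw [e1, e2, e3]; norm_num
  linear_combination (1 / 4) * (Real.sin α ^ 2) * e1 + (1 / 4) * (Real.cos α ^ 2) * e5 + (1 / 4) * e4

end RunData

theorem norm_sub_le_of_unit_intervals {f : ℝ → E3} {Λ : ℝ}
    (h : ∀ (j : ℤ) u v, (j : ℝ) ≤ u → u ≤ v → v ≤ j + 1 → ‖f v - f u‖ ≤ Λ * (v - u)) {u v : ℝ}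
    (huv : u ≤ v) : ‖f v - f u‖ ≤ Λ * (v - u) := by
  have key : ∀ (k : ℕ) (u v : ℝ), u ≤ v → v ≤ ⌊u⌋ + 1 + k → ‖f v - f u‖ ≤ Λ * (v - u) := by
    intro k
    induction k with
    | zero => intro u v huv hv; exact h ⌊u⌋ u v (Int.floor_le u) huv (by simpa using hv)
    | succ k ih =>
      intro u v huv hv
      rcases le_total v (⌊u⌋ + 1) with h1 | h1
      · exact h ⌊u⌋ u v (Int.floor_le u) huv h1
      · have h2 := ih (⌊u⌋ + 1) v h1 (by
          have : ⌊(⌊u⌋ : ℝ) + 1⌋ = ⌊u⌋ + 1 := by simp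
          rw [this]; push_cast at hv ⊢; linarith)
        have h3 := h ⌊u⌋ u (⌊u⌋ + 1) (Int.floor_le u) (Int.lt_floor_add_one u).le le_rfl
        have := norm_sub_le_norm_sub_add_norm_sub (f v) (f (⌊u⌋ + 1)) (f u)
        linarith
  obtain ⟨k, hk⟩ := exists_nat_ge (v - ⌊u⌋)
  exact key k u v huv (by linarith)

theorem monotoneOn_of_unit_intervals {f : ℝ → ℝ} {j k : ℤ} (hjk : j ≤ k)
    (h : ∀ i : ℤ, j ≤ i → i ≤ k → MonotoneOn f (Icc (i : ℝ) (i + 1))) :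
    MonotoneOn f (Icc (j : ℝ) (k + 1)) := by
  induction k, hjk using Int.leInduction with
  | base => exact h j le_rfl le_rfl
  | succ k hk ih =>
    have hk' : (j : ℝ) ≤ k := by exact_mod_cast hk
    have h1 := ih fun i hi hik => h i hi (by omega)
    have h2 := h (k + 1) (by omega) le_rfl
    push_cast at h2 ⊢
    have := h1.union_right h2 (isGreatest_Icc (by linarith)) (isLeast_Icc (by linarith))
    rwa [Icc_union_Icc_eq_Icc (by linarith) (by linarith)] at this

namespace RunData
variable (D : RunData)

theorem exists_len_le : ∃ M : ℝ, ∀ j, (D.len j : ℝ) ≤ M := by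
  obtain ⟨M, hM⟩ := ((Finset.Ico 0 D.J).image fun j => (D.len j : ℝ)).exists_le
  refine ⟨M, fun j => ?_⟩
  have hper : Function.Periodic D.len D.J := D.len_add
  have e : D.len j = D.len (j % D.J) := by
    have := hper.sub_zsmul_eq (x := j) (j / D.J)
    simp only [smul_eq_mul] at this
    rw [← this, Int.emod_def, mul_comm]
  rw [e]
  exact hM _ (Finset.mem_image_of_mem _ (Finset.mem_Ico.2
    ⟨Int.emod_nonneg _ D.J_pos.ne', Int.emod_lt_of_pos _ D.J_pos⟩))

theorem norm_curve_sub_le {M : ℝ} (hM : ∀ j, (D.len j : ℝ) ≤ M) {r : ℝ} (hr : 0 ≤ r)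
    (hr' : r ≤ 1 / 2) {u v : ℝ} (huv : u ≤ v) : ‖D.curve r v - D.curve r u‖ ≤ 6 * M * (v - u) := by
  refine norm_sub_le_of_unit_intervals (fun j u v hu huv hv => ?_) huv
  rw [D.curve_eq r hu (huv.trans hv), D.curve_eq r (hu.trans huv) hv]
  have hlen := D.seven_le_len j
  set A := D.len j * (Real.pi / 2) with hA
  have hA0 : 0 ≤ A := by positivity
  have hA2 : A ≤ 2 * M := by
    calc A ≤ D.len j * (4 / 2) := by rw [hA]; gcongr; exact Real.pi_le_four
      _ ≤ M * (4 / 2) := by gcongr; exact hM j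
      _ = _ := by ring
  rw [helix, helix, tri_sub]
  refine (norm_tri_le _ _ _ _).trans ?_
  have hs := Real.abs_sin_sub_sin_le ((v - j) * A) ((u - j) * A)
  have hc := Real.abs_cos_sub_cos_le ((v - j) * A) ((u - j) * A)
  have hd : |(v - j) * A - (u - j) * A| = (v - u) * A := by
    rw [show (v - j) * A - (u - j) * A = (v - u) * A by ring, abs_of_nonneg]
    exact mul_nonneg (by linarith) hA0
  have hvA : 0 ≤ (v - u) * A := by rw [← hd]; positivity
  rw [hd] at hs hc
  have h1 : |Real.pi / 4 * D.x (j - 3) + D.s j * ((v - j) * A) / 2 -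
      (Real.pi / 4 * D.x (j - 3) + D.s j * ((u - j) * A) / 2)| ≤ (v - u) * A := by
    rw [show Real.pi / 4 * D.x (j - 3) + D.s j * ((v - j) * A) / 2 -
      (Real.pi / 4 * D.x (j - 3) + D.s j * ((u - j) * A) / 2) =
      D.s j * ((v - u) * A / 2) by ring, abs_mul, D.abs_s, abs_of_nonneg (by linarith)]
    linarith
  have h2 : |Real.pi / 4 * D.x (j - 1) + r * (D.s (j - 1) * Real.sin ((v - j) * A)) -
      (Real.pi / 4 * D.x (j - 1) + r * (D.s (j - 1) * Real.sin ((u - j) * A)))| ≤ (v - u) * A := by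
    rw [show Real.pi / 4 * D.x (j - 1) + r * (D.s (j - 1) * Real.sin ((v - j) * A)) -
      (Real.pi / 4 * D.x (j - 1) + r * (D.s (j - 1) * Real.sin ((u - j) * A))) =
      r * (D.s (j - 1) * (Real.sin ((v - j) * A) - Real.sin ((u - j) * A))) by ring, abs_mul,
      abs_mul, D.abs_s, abs_of_nonneg hr]
    nlinarith
  have h3 : |Real.pi / 4 * D.x (j - 2) - r * (tau j * D.s (j - 1) * D.s j *
        Real.cos ((v - j) * A)) - (Real.pi / 4 * D.x (j - 2) - r * (tau j * D.s (j - 1) * D.s j *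
        Real.cos ((u - j) * A)))| ≤ (v - u) * A := by
    rw [show Real.pi / 4 * D.x (j - 2) - r * (tau j * D.s (j - 1) * D.s j *
        Real.cos ((v - j) * A)) - (Real.pi / 4 * D.x (j - 2) - r * (tau j * D.s (j - 1) * D.s j *
        Real.cos ((u - j) * A))) = -(r * (tau j * D.s (j - 1) * D.s j *
        (Real.cos ((v - j) * A) - Real.cos ((u - j) * A)))) by ring, abs_neg, abs_mul,
      abs_mul, abs_mul, abs_mul, D.abs_s, D.abs_s, abs_tau, abs_of_nonneg hr]
    nlinarith
  nlinarith

theorem core_of_ne {j : ℤ} {u : ℝ} (h : (j : ℝ) ≤ u) (h' : u ≤ j + 1) {a : Fin 3}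
    (ha : a ≠ ax j) : D.curve 0 u a = D.curve 0 j a := by
  rw [D.curve_eq 0 h h', D.curve_eq 0 le_rfl (by linarith), helix, helix]
  rcases ax_cases j a with rfl | rfl | rfl
  · exact absurd rfl ha
  · simp only [tri_snd]; ring
  · simp only [tri_trd]; ring

theorem core_ax {j : ℤ} {u : ℝ} (h : (j : ℝ) ≤ u) (h' : u ≤ j + 1) :
    D.curve 0 u (ax j) = D.curve 0 j (ax j) + D.s j * (Real.pi / 4 * D.len j * (u - j)) := by
  rw [D.curve_eq 0 h h', D.curve_eq 0 le_rfl (by linarith), helix, helix, tri_fst, tri_fst]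
  ring

theorem core_monotoneOn {j k : ℤ} (hjk : j ≤ k) {a : Fin 3} {σ : ℤ} (hσ : σ = 1 ∨ σ = -1)
    (h : ∀ i, j ≤ i → i ≤ k → ax i = a → D.s i = σ) :
    MonotoneOn (fun u => σ * D.curve 0 u a) (Icc (j : ℝ) (k + 1)) := by
  refine monotoneOn_of_unit_intervals hjk fun i hi hik u hu v hv huv => ?_
  by_cases ha : a = ax i
  · subst ha
    simp only [D.core_ax hu.1 hu.2, D.core_ax hv.1 hv.2, h i hi hik rfl]
    have hσ2 : (σ : ℝ) * σ = 1 := by rcases hσ with h | h <;> simp [h]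
    have h7 := D.seven_le_len i
    have hp := Real.pi_pos
    have : Real.pi / 4 * D.len i * (u - i) ≤ Real.pi / 4 * D.len i * (v - i) := by gcongr
    simp only [mul_add, ← mul_assoc, hσ2, one_mul]
    linarith
  · simp only [D.core_of_ne hu.1 hu.2 ha, D.core_of_ne hv.1 hv.2 ha, le_refl]

/-- On every window of `w` consecutive runs, all the runs along an axis have the same direction, with
the possible exception of one bad axis. -/
def Windows (w : ℤ) : Prop := ∀ j, ∃ (bad : Fin 3) (σ : Fin 3 → ℤ), (∀ a, σ a = 1 ∨ σ a = -1) ∧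
  ∀ i, j ≤ i → i ≤ j + w → ax i ≠ bad → D.s i = σ (ax i)

variable {D}

theorem Windows.core_gap {w : ℤ} (hw : D.Windows w) {u v : ℝ} (h2 : ⌊u⌋ + 2 ≤ ⌊v⌋)
    (hvw : ⌊v⌋ ≤ ⌊u⌋ + w) : ∃ a, 7 * Real.pi / 4 ≤ |D.curve 0 v a - D.curve 0 u a| := by
  obtain ⟨bad, σ, hσ, hs⟩ := hw ⌊u⌋
  have hp := Real.pi_pos
  have hu1 := Int.floor_le u
  have hu2 := Int.lt_floor_add_one u
  have hv1 := Int.floor_le v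
  have hv2 := Int.lt_floor_add_one v
  generalize ⌊u⌋ = i at *
  generalize ⌊v⌋ = j at *
  have h2' : (i : ℝ) + 2 ≤ j := by exact_mod_cast h2
  by_cases hm : ∃ m, i < m ∧ m < j ∧ ax m ≠ bad
  · obtain ⟨m, h3, h4, hm⟩ := hm
    have h3' : (i : ℝ) + 1 ≤ m := by exact_mod_cast h3
    have h4' : (m : ℝ) + 1 ≤ j := by exact_mod_cast h4
    refine ⟨ax m, ?_⟩
    have mono := D.core_monotoneOn (j := i) (k := j) (by omega) (hσ (ax m))
      (fun k h h' hk => by rw [hs k h (by omega) (by rwa [hk]), hk])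
    have m1 := mono ⟨hu1, by linarith⟩ ⟨by linarith, by linarith⟩ (show u ≤ m by linarith)
    have m2 := mono ⟨by linarith, by linarith⟩ ⟨by linarith, by linarith⟩
      (show (m : ℝ) + 1 ≤ v by linarith)
    have m3 := D.core_ax (j := m) (u := m + 1) (by linarith) le_rfl
    have hσ2 : (σ (ax m) : ℝ) * σ (ax m) = 1 := by rcases hσ (ax m) with h | h <;> simp [h]
    rw [hs m (by omega) (by omega) hm] at m3
    have h7 := D.seven_le_len m
    simp only [m3] at m2
    have : (7 * Real.pi / 4) ≤ σ (ax m) * (D.curve 0 v (ax m) - D.curve 0 u (ax m)) := by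
      have : Real.pi / 4 * 7 ≤ Real.pi / 4 * D.len m := by gcongr
      have e : (σ (ax m) : ℝ) * (D.curve 0 m (ax m) + σ (ax m) *
        (Real.pi / 4 * D.len m * (m + 1 - m))) = σ (ax m) * D.curve 0 m (ax m) +
          Real.pi / 4 * D.len m := by linear_combination (Real.pi / 4 * D.len m) * hσ2
      rw [e] at m2
      linarith
    refine this.trans ((le_abs_self _).trans ?_)
    rw [abs_mul]
    rcases hσ (ax m) with h | h <;> simp [h]
  · push Not at hm
    have hj : j = i + 2 := by
      by_contra hne
      have e1 := hm (i + 1) (by omega) (by omega)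
      have e2 := hm (i + 2) (by omega) (by omega)
      exact ax_ne (show i + 1 < i + 2 by omega) (by omega) (e1.trans e2.symm)
    subst hj
    push_cast at hv1 hv2
    refine ⟨ax (i + 1), ?_⟩
    have n1 : ax (i + 1) ≠ ax i := (ax_ne (by omega) (by omega)).symm
    have n2 : ax (i + 1) ≠ ax (i + 2) := ax_ne (by omega) (by omega)
    have c1 := D.core_of_ne hu1 hu2.le n1
    have c2 := D.core_of_ne (j := i) (u := i + 1) (by linarith) le_rfl n1
    have c3 := D.core_ax (j := i + 1) (u := i + 2) (by push_cast; linarith) (by push_cast; linarith)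
    have c4 := D.core_of_ne (j := i + 2) (u := v) (by push_cast; linarith) (by push_cast; linarith) n2
    push_cast at c3 c4
    have h7 := D.seven_le_len (i + 1)
    rw [c4, c3, c2, c1, add_sub_cancel_left, abs_mul, D.abs_s, one_mul,
      show (i : ℝ) + 2 - (i + 1) = 1 by ring, mul_one, abs_of_nonneg (by positivity)]
    have : Real.pi / 4 * 7 ≤ Real.pi / 4 * D.len (i + 1) := by gcongr
    linarith

theorem quarter_le_add_sin {r α : ℝ} (hr : 0 ≤ r) (hr' : r ≤ 1 / 2) (hα : 0 ≤ α) :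
    α / 4 ≤ α / 2 + r * Real.sin α := by
  rcases le_total α Real.pi with h | h
  · have := Real.sin_nonneg_of_nonneg_of_le_pi hα h
    have := mul_nonneg hr this
    linarith
  · have h1 := Real.neg_one_le_sin α
    have h2 := Real.pi_gt_three
    nlinarith

theorem near_adjacent (D : RunData) {r : ℝ} (hr : 0 ≤ r) (hr' : r ≤ 1 / 2) {j : ℤ} {u v : ℝ}
    (hu1 : (j : ℝ) ≤ u) (hu2 : u ≤ j + 1) (hv1 : (j : ℝ) + 1 ≤ v) (hv2 : v ≤ j + 2) :
    v - u ≤ ‖D.curve r v - D.curve r u‖ := by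
  have hp := Real.pi_gt_three
  set A := D.len j * (Real.pi / 2) with hA
  set B := D.len (j + 1) * (Real.pi / 2) with hB
  have h8 : ∀ k, 8 ≤ D.len k * (Real.pi / 2) := fun k => by
    have h1 := mul_le_mul (D.seven_le_len k) (show 3 / 2 ≤ Real.pi / 2 by linarith) (by norm_num)
      (by linarith [D.seven_le_len k])
    linarith
  have hA8 : 8 ≤ A := h8 j
  have hB8 : 8 ≤ B := h8 (j + 1)
  set α := (j + 1 - u) * A with hα
  set β := (v - (j + 1)) * B with hβ
  have hα0 : 0 ≤ α := mul_nonneg (by linarith) (by linarith)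
  have hβ0 : 0 ≤ β := mul_nonneg (by linarith) (by linarith)
  obtain ⟨sA, cA⟩ := D.sin_len j
  have hang : (u - j) * A = A - α := by rw [hα]; ring
  have hcos : Real.cos (A - α) = tau j * D.s (j - 1) * D.s j * D.s (j + 1) * Real.sin α := by
    rw [Real.cos_sub, cA, sA]; ring
  have c1 : (D.curve r v - D.curve r u) (ax j) = D.s j * (α / 2 + r * Real.sin β) := by
    rw [D.curve_eq r hu1 hu2, D.curve_eq r (j := j + 1) (by push_cast; linarith)
      (by push_cast; linarith), helix, helix, tri_succ, PiLp.sub_apply, tri_fst, tri_fst,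
      show j + 1 - 1 = j by ring]
    push_cast
    rw [← hA, ← hB, hang, ← hβ]
    have e := D.s_mul_len j
    linear_combination (-Real.pi / 4) * e - (D.s j : ℝ) / 2 * hA
  have c2 : (D.curve r v - D.curve r u) (ax (j - 2)) = D.s (j + 1) * (β / 2 + r * Real.sin α) := by
    rw [D.curve_eq r hu1 hu2, D.curve_eq r (j := j + 1) (by push_cast; linarith)
      (by push_cast; linarith), helix, helix, tri_succ, PiLp.sub_apply, tri_trd, tri_trd,
      show j + 1 - 3 = j - 2 by ring]
    push_cast
    rw [← hA, ← hB, hang, ← hβ, hcos]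
    have e1 := D.s_mul_self' (j - 1)
    have e2 := D.s_mul_self' j
    have e3 : (tau j : ℝ) * tau j = 1 := by exact_mod_cast tau_mul_self j
    linear_combination r * D.s (j + 1) * Real.sin α * (((D.s j : ℝ) * D.s j) * (D.s (j - 1) * D.s (j - 1)) * e3
      + (D.s (j - 1) : ℝ) * D.s (j - 1) * e2 + e1)
  have q1 := abs_coord_le (D.curve r v - D.curve r u) (ax j)
  have q2 := abs_coord_le (D.curve r v - D.curve r u) (ax (j - 2))
  rw [c1, abs_mul, D.abs_s, one_mul] at q1
  rw [c2, abs_mul, D.abs_s, one_mul] at q2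
  have q3 := (le_abs_self _).trans q1
  have q4 := (le_abs_self _).trans q2
  have q5 := quarter_le_add_sin hr hr' hα0
  have q6 := quarter_le_add_sin hr hr' hβ0
  have q7 : 8 * (j + 1 - u) ≤ α := by
    rw [hα, mul_comm]; exact mul_le_mul_of_nonneg_left hA8 (by linarith)
  have q8 : 8 * (v - (j + 1)) ≤ β := by
    rw [hβ, mul_comm]; exact mul_le_mul_of_nonneg_left hB8 (by linarith)
  linarith

theorem Windows.near {w : ℤ} (hw : D.Windows w) (hw1 : 1 ≤ w) {r : ℝ} (hr : 0 ≤ r)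
    (hr' : r ≤ 1 / 2) {u v : ℝ} (huv : u ≤ v) (hvw : v ≤ u + (w - 1)) :
    1 / w * (v - u) ≤ ‖D.curve r v - D.curve r u‖ := by
  have hp := Real.pi_gt_three
  have hw1' : (1 : ℝ) ≤ w := by exact_mod_cast hw1
  have hw2 : (1 : ℝ) / w ≤ 1 := by rw [div_le_one (by linarith)]; exact hw1'
  have hone : 1 / w * (v - u) ≤ v - u := mul_le_of_le_one_left (by linarith) hw2
  have hij : ⌊u⌋ ≤ ⌊v⌋ := Int.floor_mono huv
  have hjw : ⌊v⌋ ≤ ⌊u⌋ + w := by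
    have h1 := Int.floor_le v
    have h2 := Int.lt_floor_add_one u
    have : (⌊v⌋ : ℝ) < ⌊u⌋ + w := by linarith
    exact_mod_cast this.le
  have hu1 := Int.floor_le u
  have hu2 := Int.lt_floor_add_one u
  have hv1 := Int.floor_le v
  have hv2 := Int.lt_floor_add_one v
  rcases (by omega : ⌊v⌋ = ⌊u⌋ ∨ ⌊v⌋ = ⌊u⌋ + 1 ∨ ⌊u⌋ + 2 ≤ ⌊v⌋) with h | h | h
  · rw [h] at hv1 hv2
    generalize ⌊u⌋ = j at *
    refine hone.trans (le_trans ?_ (abs_coord_le _ (ax j)))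
    rw [D.curve_eq r hu1 hu2.le, D.curve_eq r hv1 hv2.le, helix, helix, PiLp.sub_apply, tri_fst,
      tri_fst, show Real.pi / 4 * D.x (j - 3) + D.s j * ((v - j) * (D.len j * (Real.pi / 2))) / 2 -
      (Real.pi / 4 * D.x (j - 3) + D.s j * ((u - j) * (D.len j * (Real.pi / 2))) / 2) =
      D.s j * ((v - u) * (D.len j * Real.pi / 4)) by ring, abs_mul, D.abs_s, one_mul]
    have h7 := D.seven_le_len j
    have : 1 ≤ D.len j * Real.pi / 4 := by nlinarith
    refine le_trans ?_ (le_abs_self _)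
    nlinarith
  · rw [h] at hv1 hv2
    push_cast at hv1 hv2
    exact hone.trans (D.near_adjacent hr hr' hu1 hu2.le hv1 (by linarith))
  · obtain ⟨a, ha⟩ := hw.core_gap h hjw
    have e1 := D.abs_helix_sub r hr ⌊u⌋ (Int.fract u * (D.len ⌊u⌋ * (Real.pi / 2))) a
    have e2 := D.abs_helix_sub r hr ⌊v⌋ (Int.fract v * (D.len ⌊v⌋ * (Real.pi / 2))) a
    change |D.curve r u a - D.curve 0 u a| ≤ r at e1
    change |D.curve r v a - D.curve 0 v a| ≤ r at e2
    have e3 := abs_coord_le (D.curve r v - D.curve r u) a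
    rw [PiLp.sub_apply] at e3
    have e4 : 1 / w * (v - u) ≤ 1 := by
      rw [one_div, inv_mul_le_iff₀ (by linarith)]; linarith
    obtain ⟨e5, e6⟩ := abs_le.1 e1
    obtain ⟨e7, e8⟩ := abs_le.1 e2
    have e9 : |D.curve 0 v a - D.curve 0 u a| ≤ |D.curve r v a - D.curve r u a| + 1 := by
      have := abs_le.1 (le_refl |D.curve r v a - D.curve r u a|)
      rw [abs_le]; constructor <;> linarith [this.1, this.2]
    linarith

end RunData

/-- The lattice polygon and the helical curve wound around it are ambient isotopic. -/
theorem RunData.ambientIsotopic_core_helix {n : ℕ} (D : Fin n → RunData) {w : ℤ} (hw1 : 1 ≤ w)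
    (hw : ∀ i, (D i).Windows w)
    (far : ∀ i u j v, Far (fun i => ((D i).J : ℝ)) (w - 1) i u j v →
      3 ≤ ‖(D i).curve 0 u - (D j).curve 0 v‖) :
    AmbientIsotopic (carrierOf fun i => (D i).curve 0) (carrierOf fun i => (D i).curve (1 / 2)) ∧
    ∀ i j u v, (D i).curve (1 / 2) u = (D j).curve (1 / 2) v →
      i = j ∧ ∃ z : ℤ, v = u + z * ((D i).J : ℝ) := by
  have hw1' : (0 : ℝ) < w := by exact_mod_cast (by omega : 0 < w)
  have near : ∀ i u v, u ≤ v → v ≤ u + ((w : ℝ) - 1) → ∀ s ∈ Icc (0 : ℝ) 1, 1 / w * (v - u) ≤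
      ‖linHomotopy ((D i).curve 0) ((D i).curve (1 / 2)) s v -
        linHomotopy ((D i).curve 0) ((D i).curve (1 / 2)) s u‖ := by
    intro i u v huv hv s hs
    rw [linHomotopy_curve, linHomotopy_curve]
    exact (hw i).near hw1 (by linarith [hs.1]) (by linarith [hs.2]) huv hv
  have hM : ∃ M : ℝ, ∀ i j, ((D i).len j : ℝ) ≤ M := by
    choose M hM using fun i => (D i).exists_len_le
    obtain ⟨M', hM'⟩ := (Finset.univ.image M).exists_le
    exact ⟨M', fun i j => (hM i j).trans (hM' _ (Finset.mem_image_of_mem _ (Finset.mem_univ i)))⟩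
  obtain ⟨M, hM⟩ := hM
  have close : ∀ i u, ‖(D i).curve (1 / 2) u - (D i).curve 0 u‖ ≤ 1 := fun i u =>
    ((D i).norm_curve_half_sub u).trans (by norm_num)
  have far' : ∀ i u j v, Far (fun i => ((D i).J : ℝ)) (w - 1) i u j v →
      3 * 1 ≤ ‖(D i).curve 0 u - (D j).curve 0 v‖ := by simpa using far
  refine ⟨ambientIsotopic_of_near_far (fun i => ((D i).J : ℝ)) _ _ (fun i => (D i).curve_periodic _)
    (fun i => (D i).curve_periodic _) (Λ := 12 * M) (by positivity) one_pos near ?_ far' close,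
    injective_of_near_far (fun i => ((D i).J : ℝ)) (fun i => (D i).curve 0)
      (fun i => (D i).curve (1 / 2)) (fun i => (D i).curve_periodic _) (by positivity)
      one_pos near far' close⟩
  intro i u v huv hv
  have h1 := (D i).norm_curve_sub_le (hM i) (r := 0) le_rfl (by norm_num) huv
  have h2 := (D i).norm_curve_sub_le (hM i) (r := 1 / 2) (by norm_num) le_rfl huv
  rw [sub_sub_sub_comm]
  refine (norm_sub_le _ _).trans ?_
  linarith

/-- The sign of the change of height between `k - 1` and `k + 2`. -/
def heightSign (Z : ℤ → ℤ) (k : ℤ) : ℤ := if 0 < Z (k + 2) - Z (k - 1) then 1 else -1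

theorem heightSign_eq (Z : ℤ → ℤ) (k : ℤ) : heightSign Z k = 1 ∨ heightSign Z k = -1 := by
  unfold heightSign; split_ifs <;> simp

/-- The end coordinates of the runs: the even runs end near the given heights, the odd runs
half way. -/
def runEnd (Z : ℤ → ℤ) (j : ℤ) : ℤ :=
  if Even j then Z (j / 2) + heightSign Z (j / 2 - 1) * heightSign Z (j / 2)
  else (Z (j / 2 - 1) + Z (j / 2 + 2)) / 2

/-- The directions of the runs. -/
def runSign (Z : ℤ → ℤ) (j : ℤ) : ℤ :=
  if Even j then heightSign Z (j / 2 - 2) else heightSign Z (j / 2)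

theorem runEnd_even (Z : ℤ → ℤ) (k : ℤ) :
    runEnd Z (2 * k) = Z k + heightSign Z (k - 1) * heightSign Z k := by simp [runEnd]

theorem runEnd_odd (Z : ℤ → ℤ) (k : ℤ) : runEnd Z (2 * k + 1) = (Z (k - 1) + Z (k + 2)) / 2 := by
  have : (2 * k + 1) / 2 = k := by omega
  simp [runEnd, this]

theorem runSign_even (Z : ℤ → ℤ) (k : ℤ) : runSign Z (2 * k) = heightSign Z (k - 2) := by
  simp [runSign]

theorem runSign_odd (Z : ℤ → ℤ) (k : ℤ) : runSign Z (2 * k + 1) = heightSign Z k := by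
  have : (2 * k + 1) / 2 = k := by omega
  simp [runSign, this]

theorem run_arith {z q s e : ℤ} (hz : z = 16 + 32 * q) (hs : s = if 0 < z then 1 else -1)
    (he : e = 1 ∨ e = -1) : 7 ≤ s * (8 + 16 * q + e) := by
  subst hs
  split_ifs with h <;> rcases he with rfl | rfl <;> omega

theorem heightSign_periodic {Z : ℤ → ℤ} {N : ℤ} (hZ : ∀ k, Z (k + N) = Z k) (k : ℤ) :
    heightSign Z (k + N) = heightSign Z k := by
  unfold heightSign
  rw [show k + N + 2 = k + 2 + N by ring, show k + N - 1 = k - 1 + N by ring, hZ, hZ]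

theorem even_or_odd_eq (j : ℤ) : ∃ k, j = 2 * k ∨ j = 2 * k + 1 := by
  obtain ⟨k, h⟩ := Int.even_or_odd' j; exact ⟨k, h⟩

/-- The run data obtained from a periodic sequence of heights whose increments over three steps are
odd multiples of `16`. -/
def RunData.ofHeights (Z : ℤ → ℤ) (N : ℤ) (hN : 0 < N) (h3 : 3 ∣ N) (hZ : ∀ k, Z (k + N) = Z k)
    (hodd : ∀ k, 32 ∣ Z (k + 3) - Z k - 16) : RunData where
  x := runEnd Z
  s := runSign Z
  J := 2 * N
  J_pos := by omega
  six_dvd := by omega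
  x_add := by
    intro j
    obtain ⟨k, rfl | rfl⟩ := even_or_odd_eq j
    · rw [← mul_add, runEnd_even, runEnd_even, hZ, heightSign_periodic hZ,
        show k + N - 1 = k - 1 + N by ring, heightSign_periodic hZ]
    · rw [show 2 * k + 1 + 2 * N = 2 * (k + N) + 1 by ring, runEnd_odd, runEnd_odd,
        show k + N - 1 = k - 1 + N by ring, show k + N + 2 = k + 2 + N by ring, hZ, hZ]
  s_add := by
    intro j
    obtain ⟨k, rfl | rfl⟩ := even_or_odd_eq j
    · rw [← mul_add, runSign_even, runSign_even, show k + N - 2 = k - 2 + N by ring,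
        heightSign_periodic hZ]
    · rw [show 2 * k + 1 + 2 * N = 2 * (k + N) + 1 by ring, runSign_odd, runSign_odd,
        heightSign_periodic hZ]
  s_eq := by
    intro j
    obtain ⟨k, rfl | rfl⟩ := even_or_odd_eq j
    · rw [runSign_even]; exact heightSign_eq _ _
    · rw [runSign_odd]; exact heightSign_eq _ _
  seven_le := by
    intro j
    obtain ⟨k, rfl | rfl⟩ := even_or_odd_eq j
    · obtain ⟨q, hq⟩ := hodd (k - 3)
      rw [sub_add_cancel] at hq
      have h1 : runEnd Z (2 * k - 3) = Z (k - 3) + 8 + 16 * q := by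
        rw [show 2 * k - 3 = 2 * (k - 2) + 1 by ring, runEnd_odd]
        ring_nf at hq ⊢; omega
      have he : heightSign Z (k - 1) * heightSign Z k = 1 ∨
          heightSign Z (k - 1) * heightSign Z k = -1 := by
        rcases heightSign_eq Z (k - 1) with h | h <;> rcases heightSign_eq Z k with h' | h' <;>
          simp [h, h']
      have := run_arith (z := Z k - Z (k - 3)) (q := q) (by linarith) rfl he
      rw [runSign_even, runEnd_even, h1, heightSign, show k - 2 + 2 = k by ring,
        show k - 2 - 1 = k - 3 by ring]
      convert this using 2
      linarith
    · obtain ⟨q, hq⟩ := hodd (k - 1)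
      rw [show k - 1 + 3 = k + 2 by ring] at hq
      have h1 : runEnd Z (2 * k + 1) = Z (k - 1) + 8 + 16 * q := by
        rw [runEnd_odd]; omega
      have he : -(heightSign Z (k - 2) * heightSign Z (k - 1)) = 1 ∨
          -(heightSign Z (k - 2) * heightSign Z (k - 1)) = -1 := by
        rcases heightSign_eq Z (k - 2) with h | h <;> rcases heightSign_eq Z (k - 1) with h' | h' <;>
          simp [h, h']
      have := run_arith (z := Z (k + 2) - Z (k - 1)) (q := q) (by linarith) rfl he
      rw [runSign_odd, h1, show 2 * k + 1 - 3 = 2 * (k - 1) by ring, runEnd_even, heightSign]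
      convert this using 2
      rw [show k - 1 - 1 = k - 2 by ring]
      ring
  torsion := by
    intro j
    obtain ⟨k, rfl | rfl⟩ := even_or_odd_eq j
    · obtain ⟨q, hq⟩ := hodd (k - 3)
      rw [sub_add_cancel] at hq
      have h1 : runEnd Z (2 * k - 3) = Z (k - 3) + 8 + 16 * q := by
        rw [show 2 * k - 3 = 2 * (k - 2) + 1 by ring, runEnd_odd]
        ring_nf at hq ⊢; omega
      have ht : tau (2 * k) = 1 := by simp [tau]
      rw [h1, ht, show 2 * k - 1 = 2 * (k - 1) + 1 by ring, runSign_even, runEnd_even, runSign_odd,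
        runSign_odd]
      exact ⟨heightSign Z (k - 2) * (2 + 4 * q), by linear_combination heightSign Z (k - 2) * hq⟩
    · obtain ⟨q, hq⟩ := hodd (k - 1)
      rw [show k - 1 + 3 = k + 2 by ring] at hq
      have h1 : runEnd Z (2 * k + 1) = Z (k - 1) + 8 + 16 * q := by
        rw [runEnd_odd]; omega
      have ht : tau (2 * k + 1) = -1 := by simp [tau]
      rw [h1, ht, show 2 * k + 1 - 3 = 2 * (k - 1) by ring, runEnd_even,
        show 2 * k + 1 - 1 = 2 * k by ring, show 2 * k + 1 + 1 = 2 * (k + 1) by ring, runSign_even,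
        runSign_even, runSign_odd, show k - 1 - 1 = k - 2 by ring, show k + 1 - 2 = k - 1 by ring]
      exact ⟨heightSign Z k * (2 + 4 * q), by ring⟩

/-- A multiple of `16` close to `y`, whose parity is prescribed by `k / 3`. -/
noncomputable def height (y : ℤ → ℝ) (k : ℤ) : ℤ := 16 * (2 * ⌊y k / 32⌋ + k / 3 % 2)

theorem abs_height_sub_le (y : ℤ → ℝ) (k : ℤ) : |(height y k : ℝ) - y k| ≤ 32 := by
  have h1 := Int.floor_le (y k / 32)
  have h2 := Int.lt_floor_add_one (y k / 32)
  have h3 : (0 : ℝ) ≤ (k / 3 % 2 : ℤ) := by exact_mod_cast (by omega : 0 ≤ k / 3 % 2)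
  have h4 : ((k / 3 % 2 : ℤ) : ℝ) ≤ 1 := by exact_mod_cast (by omega : k / 3 % 2 ≤ 1)
  rw [height, abs_le]
  push_cast at *
  constructor <;> linarith

theorem height_dvd (y : ℤ → ℝ) (k : ℤ) : 32 ∣ height y (k + 3) - height y k - 16 := by
  unfold height; omega

theorem height_periodic {y : ℤ → ℝ} {N : ℤ} (h6 : 6 ∣ N) (hy : ∀ k, y (k + N) = y k) (k : ℤ) :
    height y (k + N) = height y k := by
  unfold height
  rw [hy]
  have : (k + N) / 3 % 2 = k / 3 % 2 := by omega
  rw [this]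

theorem heightSign_eq_of_lt {y : ℤ → ℝ} {k : ℤ} {σ : ℤ} (hσ : σ = 1 ∨ σ = -1)
    (h : 64 < σ * (y (k + 2) - y (k - 1))) : heightSign (height y) k = σ := by
  obtain ⟨h1, h2⟩ := abs_le.1 (abs_height_sub_le y (k + 2))
  obtain ⟨h3, h4⟩ := abs_le.1 (abs_height_sub_le y (k - 1))
  unfold heightSign
  rcases hσ with rfl | rfl
  · rw [if_pos]
    have : (0 : ℝ) < height y (k + 2) - height y (k - 1) := by push_cast at h; linarith
    exact_mod_cast this
  · rw [if_neg]
    have : (height y (k + 2) : ℝ) - height y (k - 1) < 0 := by push_cast at h; linarith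
    have : height y (k + 2) - height y (k - 1) < 0 := by exact_mod_cast this
    omega

theorem combine_bound {q t : E3} {bad : Fin 3} {σ : Fin 3 → ℤ} (hσ : ∀ a, σ a = 1 ∨ σ a = -1)
    {U c κ Λ s : ℝ} (hU : 0 ≤ U) (hc : 0 < c) (hΛ : 0 ≤ Λ)
    (hq : ∀ a ≠ bad, c * U ≤ σ a * q a) (ht : ∀ a ≠ bad, 0 ≤ σ a * t a) (hκt : κ * U ≤ ‖t‖)
    (hqΛ : ‖q‖ ≤ Λ * U) (hs : s ∈ Icc (0 : ℝ) 1) :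
    min κ c / (Λ / c + 4) * U ≤ ‖q + s • (t - q)‖ := by
  set v := q + s • (t - q) with hv
  obtain ⟨hs0, hs1⟩ := hs
  have habs : ∀ a, ∀ z : ℝ, σ a * z ≤ |z| := fun a z => by
    rcases hσ a with h | h <;> rw [h] <;> push_cast
    · rw [one_mul]; exact le_abs_self z
    · rw [neg_one_mul]; exact neg_le_abs z
  have hσt : ∀ a ≠ bad, σ a * t a = |t a| := fun a ha => by
    have := ht a ha
    rw [← abs_of_nonneg this, abs_mul]
    rcases hσ a with h | h <;> simp [h]
  have hgood : ∀ a ≠ bad, (1 - s) * (c * U) + s * |t a| ≤ ‖v‖ := by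
    intro a ha
    refine le_trans ?_ ((habs a (v a)).trans (abs_coord_le v a))
    have e : (σ a : ℝ) * v a = (1 - s) * (σ a * q a) + s * (σ a * t a) := by
      simp only [hv, PiLp.add_apply, PiLp.smul_apply, PiLp.sub_apply, smul_eq_mul]; ring
    rw [e, hσt a ha]
    have := mul_le_mul_of_nonneg_left (hq a ha) (sub_nonneg.2 hs1)
    linarith
  have hbad : s * |t bad| - (1 - s) * (Λ * U) ≤ ‖v‖ := by
    refine le_trans ?_ (abs_coord_le v bad)
    have e : s * t bad = v bad - (1 - s) * q bad := by
      simp only [hv, PiLp.add_apply, PiLp.smul_apply, PiLp.sub_apply, smul_eq_mul]; ring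
    have h1 := abs_sub (v bad) ((1 - s) * q bad)
    rw [← e, abs_mul, abs_mul, abs_of_nonneg hs0, abs_of_nonneg (sub_nonneg.2 hs1)] at h1
    have h2 := mul_le_mul_of_nonneg_left ((abs_coord_le q bad).trans hqΛ) (sub_nonneg.2 hs1)
    linarith
  have hn : ‖t‖ ≤ |t 0| + |t 1| + |t 2| := by
    have := norm_tri_le 2 (t 2) (t 1) (t 0)
    have e : tri 2 (t 2) (t 1) (t 0) = t := (tri_eta 2 t).symm
    rw [e] at this; linarith
  have key : s * (κ * U) ≤ (Λ / c + 3) * ‖v‖ := by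
    have h1 : s * (κ * U) ≤ s * (|t 0| + |t 1| + |t 2|) := by gcongr; linarith
    have hC : 0 ≤ Λ / c := by positivity
    obtain ⟨a, b, ha, hb, hab⟩ : ∃ a b, a ≠ bad ∧ b ≠ bad ∧
        |t 0| + |t 1| + |t 2| = |t a| + |t b| + |t bad| := by
      fin_cases bad
      · exact ⟨1, 2, by decide, by decide, by simp; ring⟩
      · exact ⟨0, 2, by decide, by decide, by simp; ring⟩
      · exact ⟨0, 1, by decide, by decide, by simp⟩
    have g1 := hgood a ha
    have g2 := hgood b hb
    have hU' : 0 ≤ (1 - s) * (c * U) := mul_nonneg (sub_nonneg.2 hs1) (by positivity)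
    have g3 : Λ / c * ((1 - s) * (c * U)) ≤ Λ / c * ‖v‖ := by
      gcongr
      have : 0 ≤ s * |t a| := by positivity
      linarith
    have g4 : Λ / c * ((1 - s) * (c * U)) = (1 - s) * (Λ * U) := by field_simp
    rw [hab] at h1
    linarith
  have g5 : (1 - s) * (c * U) ≤ ‖v‖ := by
    obtain ⟨a, ha⟩ : ∃ a, a ≠ bad := exists_ne bad
    have := hgood a ha
    have : 0 ≤ s * |t a| := by positivity
    linarith
  have h5 : min κ c * U ≤ s * (κ * U) + (1 - s) * (c * U) := by
    have e1 : min κ c * U ≤ κ * U := by gcongr; exact min_le_left _ _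
    have e2 : min κ c * U ≤ c * U := by gcongr; exact min_le_right _ _
    have e3 := mul_le_mul_of_nonneg_left e1 hs0
    have e4 := mul_le_mul_of_nonneg_left e2 (sub_nonneg.2 hs1)
    linarith
  rw [div_mul_eq_mul_div, div_le_iff₀ (by positivity)]
  linarith

theorem ambientIsotopic_scale {n : ℕ} (γ : Fin n → ℝ → E3) {μ τ : ℝ} (hμ : 1 ≤ μ) (hτ : τ ≠ 0) :
    AmbientIsotopic (carrierOf γ) (carrierOf fun i u => μ • γ i (u / τ)) := by
  have e : carrierOf (fun i u => μ • γ i (u / τ)) = carrierOf fun i u => μ • γ i u := by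
    unfold carrierOf
    congr 1
    ext1 i
    have hs : Function.Surjective fun u : ℝ => u / τ := fun u => ⟨u * τ, by field_simp⟩
    exact hs.range_comp fun u => μ • γ i u
  rw [e, carrierOf_eq_range, carrierOf_eq_range]
  refine ambientIsotopic_of_linHomotopy _ _ (μ - 1) fun s hs a b => ?_
  simp only [linHomotopy]
  have e1 : μ • γ a.1 a.2 - γ a.1 a.2 - (μ • γ b.1 b.2 - γ b.1 b.2) =
      (μ - 1) • (γ a.1 a.2 - γ b.1 b.2) := by module
  have e2 : γ a.1 a.2 + s • (μ • γ a.1 a.2 - γ a.1 a.2) -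
      (γ b.1 b.2 + s • (μ • γ b.1 b.2 - γ b.1 b.2)) =
      (1 + s * (μ - 1)) • (γ a.1 a.2 - γ b.1 b.2) := by module
  have h1 : 0 ≤ s * (μ - 1) := mul_nonneg hs.1 (by linarith)
  rw [e1, e2, norm_smul, norm_smul, Real.norm_of_nonneg (by linarith),
    Real.norm_of_nonneg (by linarith)]
  have h2 := le_mul_of_one_le_left (norm_nonneg (γ a.1 a.2 - γ b.1 b.2))
    (show 1 ≤ 1 + s * (μ - 1) by linarith)
  exact mul_le_mul_of_nonneg_left h2 (by linarith)

theorem abs_runEnd_sub_le {f : ℝ → E3} {L : ℝ} (hL : ∀ u v, ‖f v - f u‖ ≤ L * |v - u|)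
    (hL0 : 0 ≤ L) (j : ℤ) (u : ℝ) :
    |(runEnd (height fun k => f (2 * k) (ax (2 * k))) j : ℝ) - f u (ax j)| ≤
      33 + L * (3 + |u - j|) := by
  set y : ℤ → ℝ := fun k => f (2 * k) (ax (2 * k)) with hy
  have hc : ∀ (v : ℝ) a, |f v a - f u a| ≤ L * |v - u| := fun v a => by
    have := (abs_coord_le (f v - f u) a).trans (hL u v)
    rwa [PiLp.sub_apply] at this
  have hd : ∀ k : ℤ, ax (2 * k) = ax j → |(2 * k : ℝ) - j| ≤ 3 →
      |(height y k : ℝ) - f u (ax j)| ≤ 32 + L * (3 + |u - j|) := by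
    intro k hk hkj
    have h1 := abs_height_sub_le y k
    have h2 := hc (2 * k) (ax j)
    have h3 : y k = f (2 * k) (ax j) := by rw [hy, ← hk]
    rw [h3] at h1
    have h4 := abs_sub_le (height y k : ℝ) (f (2 * k) (ax j)) (f u (ax j))
    have h5 : |(2 * k : ℝ) - u| ≤ 3 + |u - j| := by
      have := abs_sub_le (2 * k : ℝ) j u
      rw [abs_sub_comm (j : ℝ) u] at this
      linarith
    have h6 := mul_le_mul_of_nonneg_left h5 hL0
    linarith
  obtain ⟨k, rfl | rfl⟩ := even_or_odd_eq j
  · have h1 := hd k rfl (by push_cast; simp)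
    have he : |((heightSign (height y) (k - 1) * heightSign (height y) k : ℤ) : ℝ)| ≤ 1 := by
      rcases heightSign_eq (height y) (k - 1) with h | h <;>
      rcases heightSign_eq (height y) k with h' | h' <;> simp [h, h']
    rw [runEnd_even]
    push_cast at h1 he ⊢
    rw [abs_le] at *
    constructor <;> linarith [h1.1, h1.2, he.1, he.2]
  · have h1 := hd (k - 1) (by rw [ax_eq_iff]; omega) (by push_cast; rw [abs_le]; constructor <;> linarith)
    have h2 := hd (k + 2) (by rw [ax_eq_iff]; omega) (by push_cast; rw [abs_le]; constructor <;> linarith)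
    have he : ((runEnd (height y) (2 * k + 1) : ℤ) : ℝ) =
        ((height y (k - 1) : ℝ) + height y (k + 2)) / 2 := by
      rw [runEnd_odd]
      have h4 : 2 ∣ height y (k - 1) + height y (k + 2) := by unfold height; omega
      obtain ⟨z, hz⟩ := h4
      rw [hz, Int.mul_ediv_cancel_left _ (by norm_num)]
      have : ((height y (k - 1) + height y (k + 2) : ℤ) : ℝ) = ((2 * z : ℤ) : ℝ) := by rw [hz]
      push_cast at this
      linarith
    rw [he]
    rw [abs_le] at *
    constructor <;> linarith [h1.1, h1.2, h2.1, h2.2]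

theorem RunData.norm_core_sub_le (D : RunData) {f : ℝ → E3} {C : ℝ}
    (h : ∀ (j : ℤ) (u : ℝ), |u - j| ≤ 4 → |(D.x j : ℝ) - f u (ax j)| ≤ C) (u : ℝ) :
    ‖D.curve 0 u - (Real.pi / 4) • f u‖ ≤ 3 * C := by
  have h1 := Int.floor_le u
  have h2 := Int.lt_floor_add_one u
  have h0 := Int.fract_nonneg u
  have h0' := (Int.fract_lt_one u).le
  rw [curve]
  set t := Int.fract u
  generalize ⌊u⌋ = j at *
  have hC : 0 ≤ C := (abs_nonneg _).trans (h j u (by rw [abs_le]; constructor <;> linarith))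
  have hp0 := Real.pi_pos
  have hp4 := Real.pi_le_four
  have e1 := h j u (by rw [abs_le]; constructor <;> linarith)
  have e2 := h (j - 1) u (by push_cast; rw [abs_le]; constructor <;> linarith)
  have e3 := h (j - 2) u (by push_cast; rw [abs_le]; constructor <;> linarith)
  have e4 := h (j - 3) u (by push_cast; rw [abs_le]; constructor <;> linarith)
  rw [show ax (j - 3) = ax j by rw [ax_eq_iff]; omega] at e4
  have hsm : ∀ z, |z| ≤ C → |Real.pi / 4 * z| ≤ C := fun z hz => by
    rw [abs_mul, abs_of_pos (by positivity)]
    calc Real.pi / 4 * |z| ≤ 1 * C := by gcongr; linarith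
      _ = C := one_mul C
  have hl := D.s_mul_len j
  have e5 : |(D.x (j - 3) : ℝ) + t * (D.s j * D.len j) - f u (ax j)| ≤ C := by
    rw [hl, show (D.x (j - 3) : ℝ) + t * (D.x j - D.x (j - 3)) - f u (ax j) =
      (1 - t) * (D.x (j - 3) - f u (ax j)) + t * (D.x j - f u (ax j)) by ring]
    refine (abs_add_le _ _).trans ?_
    rw [abs_mul, abs_mul, abs_of_nonneg h0, abs_of_nonneg (by linarith : 0 ≤ 1 - t)]
    calc _ ≤ (1 - t) * C + t * C := by
          have : 0 ≤ 1 - t := by linarith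
          gcongr
      _ = C := by ring
  rw [tri_eta j (f u), helix, tri_smul, tri_sub]
  refine (norm_tri_le _ _ _ _).trans ?_
  have f1 := hsm _ e5
  have f2 := hsm _ e2
  have f3 := hsm _ e3
  have g1 : Real.pi / 4 * D.x (j - 3) + D.s j * (t * (D.len j * (Real.pi / 2))) / 2 -
      Real.pi / 4 * f u (ax j) =
      Real.pi / 4 * (D.x (j - 3) + t * (D.s j * D.len j) - f u (ax j)) := by ring
  rw [g1]
  have g2 : ∀ z, Real.pi / 4 * D.x (j - 1) + 0 * z - Real.pi / 4 * f u (ax (j - 1)) =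
      Real.pi / 4 * (D.x (j - 1) - f u (ax (j - 1))) := fun z => by ring
  have g3 : ∀ z, Real.pi / 4 * D.x (j - 2) - 0 * z - Real.pi / 4 * f u (ax (j - 2)) =
      Real.pi / 4 * (D.x (j - 2) - f u (ax (j - 2))) := fun z => by ring
  rw [g2, g3]
  linarith

/-- A sufficiently large curve family with generic velocity is ambient isotopic to a family of
lattice polygons that carries helices. -/
theorem exists_runData_of_large {n : ℕ} (f : Fin n → ℝ → E3) (N : Fin n → ℤ) (hN : ∀ i, 0 < N i)
    (h6 : ∀ i, 6 ∣ N i) (hf : ∀ i, Function.Periodic (f i) ((2 * N i : ℤ) : ℝ)) {L c ρ : ℝ} (hL0 : 0 ≤ L)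
    (hL : ∀ i u v, ‖f i v - f i u‖ ≤ L * |v - u|) {w : ℤ} (hw : 1 ≤ w) (hc : 64 < c * 6)
    (hwin : ∀ i (j : ℤ), ∃ (bad : Fin 3) (σ : Fin 3 → ℤ), (∀ a, σ a = 1 ∨ σ a = -1) ∧
      ∀ u v : ℝ, j - 6 ≤ u → u ≤ v → v ≤ j + w + 6 → ∀ a ≠ bad,
        c * (v - u) ≤ σ a * (f i v a - f i u a))
    (hρ : 3 ≤ ρ) (hρL : 99 + 21 * L ≤ ρ)
    (far : ∀ i u j v, Far (fun i => ((2 * N i : ℤ) : ℝ)) (w - 1) i u j v →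
      4 * ρ ≤ ‖f i u - f j v‖) :
    ∃ D : Fin n → RunData, (∀ i, (D i).Windows w) ∧
      (∀ i u j v, Far (fun i => ((D i).J : ℝ)) (w - 1) i u j v →
        3 ≤ ‖(D i).curve 0 u - (D j).curve 0 v‖) ∧
      AmbientIsotopic (carrierOf fun i u => (Real.pi / 4) • f i u)
        (carrierOf fun i => (D i).curve 0) := by
  have hp0 := Real.pi_pos
  have hp3 := Real.pi_gt_three
  have hp4 := Real.pi_le_four
  have hc0 : 0 < c := by linarith
  let y : Fin n → ℤ → ℝ := fun i k => f i (2 * k) (ax (2 * k))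
  have hy : ∀ i k, y i (k + N i) = y i k := by
    intro i k
    have h1 : ax (2 * (k + N i)) = ax (2 * k) := by
      rw [ax_eq_iff]; have := h6 i; omega
    have h2 := hf i (2 * k)
    push_cast at h2
    simp only [y, h1]
    push_cast
    rw [mul_add, h2]
  let D : Fin n → RunData := fun i => RunData.ofHeights (height (y i)) (N i) (hN i)
    (by have := h6 i; omega) (height_periodic (h6 i) (hy i)) (height_dvd (y i))
  have hx : ∀ i (j : ℤ) (u : ℝ), |u - j| ≤ 4 → |((D i).x j : ℝ) - f i u (ax j)| ≤ 33 + 7 * L := by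
    intro i j u hu
    have := abs_runEnd_sub_le (hL i) hL0 j u
    have h2 : L * (3 + |u - j|) ≤ L * 7 := by gcongr; linarith
    change |((D i).x j : ℝ) - f i u (ax j)| ≤ _ at this
    linarith
  have close : ∀ i u, ‖(D i).curve 0 u - (Real.pi / 4) • f i u‖ ≤ ρ := by
    intro i u
    have := (D i).norm_core_sub_le (hx i) u
    linarith
  have hwin' : ∀ i (j : ℤ), ∃ (bad : Fin 3) (σ : Fin 3 → ℤ), (∀ a, σ a = 1 ∨ σ a = -1) ∧
      (∀ u v : ℝ, j - 6 ≤ u → u ≤ v → v ≤ j + w + 6 → ∀ a ≠ bad,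
        c * (v - u) ≤ σ a * (f i v a - f i u a)) ∧
      ∀ k, j ≤ k → k ≤ j + w → ax k ≠ bad → (D i).s k = σ (ax k) := by
    intro i j
    obtain ⟨bad, σ, hσ, h⟩ := hwin i j
    refine ⟨bad, σ, hσ, h, fun k hjk hkw hk => ?_⟩
    change runSign (height (y i)) k = _
    have hjk' : (j : ℝ) ≤ k := by exact_mod_cast hjk
    have hkw' : (k : ℝ) ≤ j + w := by exact_mod_cast hkw
    obtain ⟨l, rfl | rfl⟩ := even_or_odd_eq k
    · push_cast at hjk' hkw'
      rw [runSign_even]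
      refine heightSign_eq_of_lt (hσ _) ?_
      have h1 : ax (2 * (l - 2 - 1)) = ax (2 * l) := by rw [ax_eq_iff]; omega
      have := h (2 * l - 6) (2 * l) (by linarith) (by linarith) (by linarith) _ hk
      simp only [y, h1, show l - 2 + 2 = l by ring]
      push_cast
      rw [show (2 : ℝ) * (l - 2 - 1) = 2 * l - 6 by ring]
      linarith
    · push_cast at hjk' hkw'
      rw [runSign_odd]
      refine heightSign_eq_of_lt (hσ _) ?_
      have h1 : ax (2 * (l - 1)) = ax (2 * l + 1) := by rw [ax_eq_iff]; omega
      have h2 : ax (2 * (l + 2)) = ax (2 * l + 1) := by rw [ax_eq_iff]; omega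
      have := h (2 * l - 2) (2 * l + 4) (by linarith) (by linarith) (by linarith) _ hk
      simp only [y, h1, h2]
      push_cast
      rw [show (2 : ℝ) * (l - 1) = 2 * l - 2 by ring, show (2 : ℝ) * (l + 2) = 2 * l + 4 by ring]
      linarith
  have hW : ∀ i, (D i).Windows w := fun i j => by
    obtain ⟨bad, σ, hσ, -, h⟩ := hwin' i j
    exact ⟨bad, σ, hσ, h⟩
  have hw1' : (0 : ℝ) < w := by exact_mod_cast (by omega : 0 < w)
  have hper0 : ∀ i, Function.Periodic (fun u => (Real.pi / 4) • f i u) ((D i).J : ℝ) := fun i u => by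
    have := hf i u
    change (Real.pi / 4) • f i (u + ((2 * N i : ℤ) : ℝ)) = _
    rw [this]
  have far0 : ∀ i u j v, Far (fun i => ((D i).J : ℝ)) (w - 1) i u j v →
      3 * ρ ≤ ‖(Real.pi / 4) • f i u - (Real.pi / 4) • f j v‖ := by
    intro i u j v h
    rw [← smul_sub, norm_smul, Real.norm_of_nonneg (by positivity)]
    have := far i u j v h
    calc 3 * ρ = 3 / 4 * (4 * ρ) := by ring
      _ ≤ Real.pi / 4 * ‖f i u - f j v‖ := by gcongr
  have hM : ∃ M : ℝ, ∀ i j, ((D i).len j : ℝ) ≤ M := by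
    choose M hM using fun i => (D i).exists_len_le
    obtain ⟨M', hM'⟩ := (Finset.univ.image M).exists_le
    exact ⟨M', fun i j => (hM i j).trans (hM' _ (Finset.mem_image_of_mem _ (Finset.mem_univ i)))⟩
  obtain ⟨M, hM⟩ := hM
  have hfL : ∀ i u v, u ≤ v → ‖(Real.pi / 4) • f i v - (Real.pi / 4) • f i u‖ ≤ L * (v - u) := by
    intro i u v huv
    rw [← smul_sub, norm_smul, Real.norm_of_nonneg (by positivity)]
    have := hL i u v
    rw [abs_of_nonneg (by linarith)] at this
    calc _ ≤ 1 * ‖f i v - f i u‖ := by gcongr; linarith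
      _ ≤ _ := by rw [one_mul]; exact this
  refine ⟨D, hW, ?_, ?_⟩
  · intro i u j v h
    have h1 := far0 i u j v h
    have h2 := close i u
    have h3 := close j v
    have e : (Real.pi / 4) • f i u - (Real.pi / 4) • f j v =
        ((D i).curve 0 u - (D j).curve 0 v) - (((D i).curve 0 u - (Real.pi / 4) • f i u) -
          ((D j).curve 0 v - (Real.pi / 4) • f j v)) := by abel
    rw [e] at h1
    have h4 := norm_sub_le ((D i).curve 0 u - (D j).curve 0 v) (((D i).curve 0 u -
      (Real.pi / 4) • f i u) - ((D j).curve 0 v - (Real.pi / 4) • f j v))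
    have h5 := norm_sub_le ((D i).curve 0 u - (Real.pi / 4) • f i u)
      ((D j).curve 0 v - (Real.pi / 4) • f j v)
    linarith
  · refine ambientIsotopic_of_near_far (fun i => ((D i).J : ℝ)) _ _ hper0
      (fun i => (D i).curve_periodic _) (W := w - 1) (Λ := 6 * M + L)
      (κ := min (1 / (w : ℝ)) (Real.pi / 4 * c) / (L / (Real.pi / 4 * c) + 4)) (ρ := ρ) ?_
      (by linarith) ?_ ?_ far0 close
    · have : 0 < min (1 / (w : ℝ)) (Real.pi / 4 * c) := lt_min (by positivity) (by positivity)
      positivity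
    · intro i u v huv hv s hs
      obtain ⟨bad, σ, hσ, h1, h2⟩ := hwin' i ⌊u⌋
      have hu1 := Int.floor_le u
      have hu2 := Int.lt_floor_add_one u
      have e : linHomotopy (fun u => (Real.pi / 4) • f i u) ((D i).curve 0) s v -
          linHomotopy (fun u => (Real.pi / 4) • f i u) ((D i).curve 0) s u =
          ((Real.pi / 4) • f i v - (Real.pi / 4) • f i u) +
          s • (((D i).curve 0 v - (D i).curve 0 u) -
            ((Real.pi / 4) • f i v - (Real.pi / 4) • f i u)) := by
        simp only [linHomotopy]; module
      rw [e]
      refine combine_bound (bad := bad) (σ := σ) hσ (by linarith) (by positivity) hL0 ?_ ?_ ?_ ?_ hs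
      · intro a ha
        have := h1 u v (by linarith) huv (by linarith) a ha
        rw [← smul_sub, PiLp.smul_apply, PiLp.sub_apply, smul_eq_mul]
        calc Real.pi / 4 * c * (v - u) = Real.pi / 4 * (c * (v - u)) := by ring
          _ ≤ Real.pi / 4 * (σ a * (f i v a - f i u a)) := by gcongr
          _ = _ := by ring
      · intro a ha
        have mono := (D i).core_monotoneOn (j := ⌊u⌋) (k := ⌊u⌋ + w) (by omega) (hσ a)
          (fun k hk hk' hka => by rw [h2 k hk hk' (by rwa [hka]), hka])
        push_cast at mono
        have := mono ⟨hu1, by linarith⟩ ⟨by linarith, by linarith⟩ huv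
        simp only at this
        rw [PiLp.sub_apply, mul_sub]
        linarith
      · exact (hW i).near hw le_rfl (by norm_num) huv hv
      · exact hfL i u v huv
    · intro i u v huv hv
      have a1 := (D i).norm_curve_sub_le (hM i) (r := 0) le_rfl (by norm_num) huv
      have a2 := hfL i u v huv
      rw [sub_sub_sub_comm]
      refine (norm_sub_le _ _).trans ?_
      linarith

theorem exists_runData {n : ℕ} {m : Fin n → ℕ} (hm : ∀ i, 0 < m i) {Q : Fin n → ℝ → E3}
    (hper : ∀ i, Function.Periodic (Q i) (m i)) {Λ c η : ℝ} (hΛ : 0 ≤ Λ)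
    (hlip : ∀ i u v, ‖Q i v - Q i u‖ ≤ Λ * |v - u|) (hc : 0 < c) (hη : 0 < η)
    (hwin : ∀ i u, ∃ (bad : Fin 3) (σ : Fin 3 → ℤ), (∀ a, σ a = 1 ∨ σ a = -1) ∧
      ∀ v w, u ≤ v → v ≤ w → w ≤ u + η → ∀ a ≠ bad, c * (w - v) ≤ σ a * (Q i w a - Q i v a))
    (hinj : ∀ i j u v, Q i u = Q j v → i = j ∧ ∃ z : ℤ, v = u + z * (m i : ℝ)) :
    ∃ (D : Fin n → RunData) (w : ℤ), 1 ≤ w ∧ (∀ i, (D i).Windows w) ∧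
      (∀ i u j v, Far (fun i => ((D i).J : ℝ)) (w - 1) i u j v →
        3 ≤ ‖(D i).curve 0 u - (D j).curve 0 v‖) ∧
      AmbientIsotopic (carrierOf Q) (carrierOf fun i => (D i).curve 0) := by
  have hcont : ∀ i, Continuous (Q i) := fun i =>
    continuous_of_lip_near (B := Λ) fun x y hxy _ => by
      have := hlip i x y; rwa [abs_of_nonneg (by linarith)] at this
  obtain ⟨ρ, hρ, hfar⟩ := exists_far_bound (fun i => (m i : ℝ)) (fun i => by exact_mod_cast hm i) Q
    hcont hper hinj (W := η / 4) (by positivity)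
  obtain ⟨K, hK⟩ := exists_nat_ge (max (2 / η) (max (24 * Λ / ρ) 1))
  have hK1 : (1 : ℝ) ≤ K := (le_max_right _ _).trans ((le_max_right _ _).trans hK)
  have hK2 : 2 ≤ K * η := by
    rw [← div_le_iff₀ hη]; exact (le_max_left _ _).trans hK
  have hK3 : 24 * Λ ≤ K * ρ := by
    rw [← div_le_iff₀ hρ]; exact (le_max_left _ _).trans ((le_max_right _ _).trans hK)
  have hK0 : (0 : ℝ) < K := by linarith
  obtain ⟨ν, hν⟩ := exists_nat_ge (max (1000 / ρ) (max (200 * K / c) 2))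
  have hν1 : (2 : ℝ) ≤ ν := (le_max_right _ _).trans ((le_max_right _ _).trans hν)
  have hν2 : 1000 ≤ ν * ρ := by rw [← div_le_iff₀ hρ]; exact (le_max_left _ _).trans hν
  have hν3 : 200 * K ≤ ν * c := by
    rw [← div_le_iff₀ hc]; exact (le_max_left _ _).trans ((le_max_right _ _).trans hν)
  set T : ℝ := 12 * K with hT
  have hT0 : 0 < T := by positivity
  set w : ℤ := ⌊6 * K * η⌋ with hw
  have hw1 := Int.floor_le (6 * K * η)
  have hw2 := Int.lt_floor_add_one (6 * K * η)
  rw [← hw] at hw1 hw2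
  have hw11 : (11 : ℝ) ≤ w := by
    have : (11 : ℤ) ≤ w := by
      rw [hw, Int.le_floor]; push_cast; linarith
    exact_mod_cast this
  have hw1z : 1 ≤ w := by
    have : (1 : ℝ) ≤ w := by linarith
    exact_mod_cast this
  let f : Fin n → ℝ → E3 := fun i u => (ν : ℝ) • Q i (u / T)
  have b1 : ∀ i u v, ‖f i v - f i u‖ ≤ ν * Λ / T * |v - u| := by
    intro i u v
    simp only [f]
    rw [← smul_sub, norm_smul, Real.norm_of_nonneg (by positivity)]
    have := hlip i (u / T) (v / T)
    rw [← sub_div, abs_div, abs_of_pos hT0] at this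
    calc (ν : ℝ) * ‖Q i (v / T) - Q i (u / T)‖ ≤ ν * (Λ * (|v - u| / T)) := by gcongr
      _ = _ := by ring
  have b2 : 64 < ν * c / T * 6 := by
    rw [div_mul_eq_mul_div, lt_div_iff₀ hT0, hT]; linarith
  have b3 : ∀ i (j : ℤ), ∃ (bad : Fin 3) (σ : Fin 3 → ℤ), (∀ a, σ a = 1 ∨ σ a = -1) ∧
      ∀ u v : ℝ, j - 6 ≤ u → u ≤ v → v ≤ j + w + 6 → ∀ a ≠ bad,
        ν * c / T * (v - u) ≤ σ a * (f i v a - f i u a) := by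
    intro i j
    obtain ⟨bad, σ, hσ, h⟩ := hwin i ((j - 6) / T)
    refine ⟨bad, σ, hσ, fun u v hu huv hv a ha => ?_⟩
    have := h (u / T) (v / T) (by gcongr) (by gcongr) (by
      rw [div_add' _ _ _ hT0.ne']
      gcongr
      rw [hT]; linarith) a ha
    simp only [f, PiLp.smul_apply, smul_eq_mul]
    calc ν * c / T * (v - u) = ν * (c * (v / T - u / T)) := by ring
      _ ≤ ν * (σ a * (Q i (v / T) a - Q i (u / T) a)) := by gcongr
      _ = _ := by ring
  have b4 : 3 ≤ ν * ρ / 4 := by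
    linarith
  have b5 : 99 + 21 * (ν * Λ / T) ≤ ν * ρ / 4 := by
    have : ν * Λ / T ≤ ν * ρ / 288 := by
      rw [div_le_div_iff₀ hT0 (by norm_num), hT]
      have := mul_le_mul_of_nonneg_left hK3 (by linarith : (0 : ℝ) ≤ ν)
      linarith
    linarith
  have b6 : ∀ i u j v, Far (fun i => ((2 * (6 * K * m i : ℤ) : ℤ) : ℝ)) (w - 1) i u j v →
      4 * (ν * ρ / 4) ≤ ‖f i u - f j v‖ := by
    intro i u j v h
    simp only [f]
    rw [← smul_sub, norm_smul, Real.norm_of_nonneg (by positivity)]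
    have hF : Far (fun i => (m i : ℝ)) (η / 4) i (u / T) j (v / T) := by
      intro hij z
      have := h hij z
      have e : v / T - u / T + z * (m i : ℝ) = (v - u + z * ((2 * (6 * K * m i) : ℤ) : ℝ)) / T := by
        push_cast
        rw [hT]
        field_simp
        ring
      rw [e, abs_div, abs_of_pos hT0, lt_div_iff₀ hT0]
      refine lt_of_le_of_lt ?_ this
      rw [hT]; linarith
    have := hfar _ _ _ _ hF
    calc 4 * ((ν : ℝ) * ρ / 4) = ν * ρ := by ring
      _ ≤ _ := by gcongr
  obtain ⟨D, h1, h2, h3⟩ := exists_runData_of_large f (fun i => 6 * K * m i) (fun i => by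
      have : 0 < K := by exact_mod_cast hK0
      have := hm i
      positivity) (fun i => ⟨K * m i, by ring⟩) (fun i u => by
      simp only [f]
      congr 1
      rw [← hper i (u / T)]
      congr 1
      push_cast
      rw [hT]
      field_simp
      ring) (L := ν * Λ / T) (c := ν * c / T) (ρ := ν * ρ / 4) (w := w) (by positivity) b1 hw1z b2 b3
      b4 b5 b6
  · refine ⟨D, w, hw1z, h1, h2, ?_⟩
    refine AmbientIsotopic.trans ?_ h3
    have hp := Real.pi_gt_three
    have := ambientIsotopic_scale Q (μ := Real.pi / 4 * ν) (τ := T) (by nlinarith) hT0.ne'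
    simpa only [f, smul_smul] using this

/-- The antiderivative of an integer sequence that vanishes at `0`. -/
def cumul (l : ℤ → ℤ) : ℤ → ℤ
  | Int.ofNat k => ∑ i ∈ Finset.range k, l i
  | Int.negSucc k => -∑ i ∈ Finset.range (k + 1), l (Int.negSucc i)

theorem cumul_zero (l : ℤ → ℤ) : cumul l 0 = 0 := by
  change ∑ i ∈ Finset.range 0, l i = 0
  simp

theorem cumul_succ (l : ℤ → ℤ) (j : ℤ) : cumul l (j + 1) = cumul l j + l j := by
  rcases j with k | k
  · exact Finset.sum_range_succ _ k
  · rcases k with _ | k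
    · change cumul l 0 = -∑ i ∈ Finset.range 1, l (Int.negSucc i) + _
      rw [cumul_zero]
      simp
    · change -∑ i ∈ Finset.range (k + 1), l (Int.negSucc i) =
        -∑ i ∈ Finset.range (k + 1 + 1), l (Int.negSucc i) + l (Int.negSucc (k + 1))
      rw [Finset.sum_range_succ _ (k + 1)]
      ring

theorem cumul_add {l : ℤ → ℤ} {J : ℤ} (hl : ∀ j, l (j + J) = l j) (j : ℤ) :
    cumul l (j + J) = cumul l j + cumul l J := by
  have h1 : ∀ j, cumul l (j + 1 + J) = cumul l (j + J) + l j := fun j => by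
    rw [show j + 1 + J = j + J + 1 by ring, cumul_succ, hl]
  induction j using Int.induction_on with
  | zero => simp [cumul_zero]
  | succ k ih => rw [h1, ih, cumul_succ]; ring
  | pred k ih =>
    have e1 := h1 (-k - 1)
    have e2 := cumul_succ l (-k - 1)
    rw [sub_add_cancel] at e1 e2
    linarith

theorem cumul_add_mul {l : ℤ → ℤ} {J : ℤ} (hJ : J ≠ 0) (hl : ∀ j, l (j + J) = l j) (j z : ℤ) :
    cumul l (j + z * J) = cumul l j + z * cumul l J := by
  have hp : Function.Periodic (fun j => cumul l j * J - cumul l J * j) J := fun j => by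
    simp only [cumul_add hl]; ring
  have := hp.int_mul z j
  simp only [Int.cast_id] at this
  apply mul_right_cancel₀ hJ
  linarith

theorem cumul_strictMono {l : ℤ → ℤ} (hl : ∀ j, 1 ≤ l j) : StrictMono (cumul l) :=
  strictMono_int_of_lt_succ fun j => by rw [cumul_succ]; have := hl j; omega

theorem exists_cumul_le_lt {l : ℤ → ℤ} (hl : ∀ j, 1 ≤ l j) (q : ℤ) :
    ∃ j, cumul l j ≤ q ∧ q < cumul l (j + 1) := by
  have hm : Monotone fun j => cumul l j - j := monotone_int_of_le_succ fun j => by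
    have := hl j
    simp only [cumul_succ]; omega
  have h0 := cumul_zero l
  obtain ⟨j, hj, hmax⟩ := Int.exists_greatest_of_bdd (P := fun z => cumul l z ≤ q)
    ⟨max q 0, fun z hz => by
      rcases le_total z 0 with h | h
      · omega
      · have : cumul l 0 - 0 ≤ cumul l z - z := hm h
        omega⟩
    ⟨min q 0, by
      have : cumul l (min q 0) - min q 0 ≤ cumul l 0 - 0 := hm (min_le_right _ _)
      omega⟩
  refine ⟨j, hj, ?_⟩
  by_contra h
  have := hmax (j + 1) (not_lt.1 h)
  omega

/-- Pieces `f j` on the intervals `[β j, β (j + 1)]`, glued together. -/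
structure Gluing where
  β : ℤ → ℝ
  idx : ℝ → ℤ
  mono : StrictMono β
  idx_spec : ∀ x, β (idx x) ≤ x ∧ x < β (idx x + 1)

namespace Gluing
variable (G : Gluing)

/-- The glued function. -/
def glue (f : ℤ → ℝ → E3) (x : ℝ) : E3 := f (G.idx x) x

theorem idx_eq {j : ℤ} {x : ℝ} (h : G.β j ≤ x) (h' : x < G.β (j + 1)) : G.idx x = j := by
  obtain ⟨h1, h2⟩ := G.idx_spec x
  have h3 := G.mono.lt_iff_lt.1 (h1.trans_lt h')
  have h4 := G.mono.lt_iff_lt.1 (h.trans_lt h2)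
  omega

variable {f g : ℤ → ℝ → E3}

theorem glue_eq (hf : ∀ j, f j (G.β (j + 1)) = f (j + 1) (G.β (j + 1))) {j : ℤ} {x : ℝ}
    (h : G.β j ≤ x) (h' : x ≤ G.β (j + 1)) : G.glue f x = f j x := by
  rcases h'.lt_or_eq with h' | rfl
  · rw [glue, G.idx_eq h h']
  · rw [glue, G.idx_eq le_rfl (G.mono (by omega : j + 1 < j + 1 + 1)), hf]

open Filter Topology in
theorem glue_eventuallyEq_right (x : ℝ) : G.glue f =ᶠ[𝓝[≥] x] f (G.idx x) := by
  obtain ⟨h1, h2⟩ := G.idx_spec x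
  filter_upwards [Ico_mem_nhdsGE h2] with y hy
  rw [glue, G.idx_eq (h1.trans hy.1) hy.2]

open Filter Topology in
theorem glue_eventuallyEq_left (hf : ∀ j, f j (G.β (j + 1)) = f (j + 1) (G.β (j + 1))) (x : ℝ) :
    ∃ j, G.glue f =ᶠ[𝓝[≤] x] f j ∧ G.β j ≤ x ∧ x ≤ G.β (j + 1) := by
  obtain ⟨h1, h2⟩ := G.idx_spec x
  obtain ⟨j, hj1, hj2⟩ : ∃ j, G.β j < x ∧ x ≤ G.β (j + 1) := by
    rcases h1.lt_or_eq with h1 | h1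
    · exact ⟨_, h1, h2.le⟩
    · refine ⟨G.idx x - 1, (G.mono (by omega : G.idx x - 1 < G.idx x)).trans_eq h1, ?_⟩
      rw [sub_add_cancel, h1]
  refine ⟨j, ?_, hj1.le, hj2⟩
  filter_upwards [Ioc_mem_nhdsLE hj1] with y hy
  exact G.glue_eq hf hy.1.le (hy.2.trans hj2)

theorem continuous_glue (hf : ∀ j, f j (G.β (j + 1)) = f (j + 1) (G.β (j + 1)))
    (hc : ∀ j, Continuous (f j)) : Continuous (G.glue f) := by
  rw [continuous_iff_continuousAt]
  intro x
  obtain ⟨j, hj, h1, h2⟩ := G.glue_eventuallyEq_left hf x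
  rw [continuousAt_iff_continuous_left_right]
  exact ⟨((hc j).continuousWithinAt).congr_of_eventuallyEq hj (G.glue_eq hf h1 h2),
    ((hc _).continuousWithinAt).congr_of_eventuallyEq (G.glue_eventuallyEq_right x) rfl⟩

theorem hasDerivAt_glue (hf : ∀ j, f j (G.β (j + 1)) = f (j + 1) (G.β (j + 1)))
    (hg : ∀ j, g j (G.β (j + 1)) = g (j + 1) (G.β (j + 1)))
    (hd : ∀ j x, HasDerivAt (f j) (g j x) x) (x : ℝ) :
    HasDerivAt (G.glue f) (G.glue g x) x := by
  obtain ⟨j, hj, h1, h2⟩ := G.glue_eventuallyEq_left hf x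
  have hl : HasDerivWithinAt (G.glue f) (G.glue g x) (Iic x) x := by
    rw [G.glue_eq hg h1 h2]
    exact (hd j x).hasDerivWithinAt.congr_of_eventuallyEq hj (G.glue_eq hf h1 h2)
  have hr : HasDerivWithinAt (G.glue f) (G.glue g x) (Ici x) x :=
    (hd _ x).hasDerivWithinAt.congr_of_eventuallyEq (G.glue_eventuallyEq_right x) rfl
  have := hl.union hr
  rwa [Iic_union_Ici, hasDerivWithinAt_univ] at this

end Gluing

theorem hasDerivAt_tri (j : ℤ) {A B C : ℝ → ℝ} {A' B' C' x : ℝ} (hA : HasDerivAt A A' x)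
    (hB : HasDerivAt B B' x) (hC : HasDerivAt C C' x) :
    HasDerivAt (fun x => tri j (A x) (B x) (C x)) (tri j A' B' C') x := by
  have e : ∀ a b c, tri j a b c = a • tri j 1 0 0 + b • tri j 0 1 0 + c • tri j 0 0 1 := by
    intro a b c
    simp only [tri_smul, tri_add]
    congr 1 <;> ring
  rw [e A' B' C']
  exact (((hA.smul_const _).add (hB.smul_const _)).add (hC.smul_const _)).congr_of_eventuallyEq
    (.of_forall fun x => e (A x) (B x) (C x))

/-- The speed of the helix of radius `1 / 2` and slope `1 / 2` with respect to the angle. -/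
noncomputable def helixSpeed : ℝ := √((1 / 2 : ℝ) ^ 2 + (1 / 2) ^ 2)

theorem helixSpeed_pos : 0 < helixSpeed := Real.sqrt_pos.2 (by norm_num)

theorem helixSpeed_sq : helixSpeed ^ 2 = 1 / 2 := by
  rw [helixSpeed, Real.sq_sqrt (by norm_num)]; norm_num

/-- The arclength of a quarter turn. -/
noncomputable def quarterLength : ℝ := helixSpeed * (Real.pi / 2)

theorem quarterLength_pos : 0 < quarterLength :=
  mul_pos helixSpeed_pos (by positivity)

theorem quarterLength_div : quarterLength / helixSpeed = Real.pi / 2 := by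
  have := helixSpeed_pos.ne'
  rw [quarterLength]; field_simp

namespace RunData
variable (D : RunData)

theorem one_le_len (j : ℤ) : 1 ≤ D.len j := by have := D.seven_le j; rw [len]; omega

/-- The number of quarter turns before the run `j`. -/
def start : ℤ → ℤ := cumul D.len

theorem start_succ (j : ℤ) : D.start (j + 1) = D.start j + D.len j := cumul_succ _ _

theorem exists_start_le_lt (y : ℝ) : ∃ j, (D.start j : ℝ) ≤ y ∧ y < D.start (j + 1) := by
  obtain ⟨j, h1, h2⟩ := exists_cumul_le_lt D.one_le_len ⌊y⌋
  exact ⟨j, Int.le_floor.1 h1, Int.floor_lt.1 h2⟩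

/-- The division of the arclength parameter into the runs. -/
noncomputable def gluing : Gluing where
  β j := D.start j * quarterLength
  idx x := (D.exists_start_le_lt (x / quarterLength)).choose
  mono := fun i j h => by
    have := cumul_strictMono D.one_le_len h
    have : (D.start i : ℝ) < D.start j := by exact_mod_cast this
    exact mul_lt_mul_of_pos_right this quarterLength_pos
  idx_spec x := by
    obtain ⟨h1, h2⟩ := (D.exists_start_le_lt (x / quarterLength)).choose_spec
    exact ⟨(le_div_iff₀ quarterLength_pos).1 h1, (div_lt_iff₀ quarterLength_pos).1 h2⟩

/-- The angle on the run `j`, as a function of the arclength. -/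
noncomputable def angle (j : ℤ) (x : ℝ) : ℝ := x / helixSpeed - D.start j * (Real.pi / 2)

/-- The run `j` in terms of the arclength. -/
noncomputable def run (j : ℤ) (x : ℝ) : E3 := D.helix (1 / 2) j (D.angle j x)

/-- The velocity on the run `j`. -/
noncomputable def runVel (j : ℤ) (x : ℝ) : E3 := (1 / helixSpeed) •
  tri j (D.s j / 2) (D.s (j - 1) * Real.cos (D.angle j x) / 2)
    (tau j * D.s (j - 1) * D.s j * Real.sin (D.angle j x) / 2)

/-- The acceleration on the run `j`. -/
noncomputable def runAcc (j : ℤ) (x : ℝ) : E3 :=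
  tri j 0 (-(D.s (j - 1) * Real.sin (D.angle j x)))
    (tau j * D.s (j - 1) * D.s j * Real.cos (D.angle j x))

theorem angle_end (j : ℤ) : D.angle j (D.gluing.β (j + 1)) = D.len j * (Real.pi / 2) := by
  change D.start (j + 1) * quarterLength / helixSpeed - _ = _
  rw [mul_div_assoc, quarterLength_div, start_succ]
  push_cast; ring

theorem angle_start (j : ℤ) : D.angle j (D.gluing.β j) = 0 := by
  change D.start j * quarterLength / helixSpeed - _ = _
  rw [mul_div_assoc, quarterLength_div, sub_self]

theorem run_match (j : ℤ) :
    D.run j (D.gluing.β (j + 1)) = D.run (j + 1) (D.gluing.β (j + 1)) := by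
  rw [run, run, angle_end, angle_start, helix_end]

theorem runVel_match (j : ℤ) :
    D.runVel j (D.gluing.β (j + 1)) = D.runVel (j + 1) (D.gluing.β (j + 1)) := by
  obtain ⟨h1, h2⟩ := D.sin_len j
  have e1 := D.s_mul_self' (j - 1)
  have e2 := D.s_mul_self' j
  have e3 : (tau j : ℝ) * tau j = 1 := by exact_mod_cast tau_mul_self j
  rw [runVel, runVel, angle_end, angle_start, h1, h2, tri_succ, Real.sin_zero, Real.cos_zero,
    add_sub_cancel_right]
  congr 2
  · ring
  · ring
  · linear_combination (D.s (j + 1) / 2 : ℝ) *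
      (((D.s j : ℝ) * D.s j) * (D.s (j - 1) * D.s (j - 1)) * e3 +
        (D.s (j - 1) : ℝ) * D.s (j - 1) * e2 + e1)

theorem runAcc_match (j : ℤ) :
    D.runAcc j (D.gluing.β (j + 1)) = D.runAcc (j + 1) (D.gluing.β (j + 1)) := by
  obtain ⟨h1, h2⟩ := D.sin_len j
  have e1 := D.s_mul_self' (j - 1)
  rw [runAcc, runAcc, angle_end, angle_start, h1, h2, tri_succ, Real.sin_zero, Real.cos_zero,
    add_sub_cancel_right, tau_succ]
  push_cast
  congr 1
  · ring
  · linear_combination (-tau j * D.s j * D.s (j + 1) : ℝ) * e1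
  · ring

theorem hasDerivAt_angle (j : ℤ) (x : ℝ) : HasDerivAt (D.angle j) (1 / helixSpeed) x :=
  ((hasDerivAt_id x).div_const _).sub_const _

theorem hasDerivAt_run (j : ℤ) (x : ℝ) : HasDerivAt (D.run j) (D.runVel j x) x := by
  have ha := D.hasDerivAt_angle j x
  rw [runVel, tri_smul]
  refine hasDerivAt_tri j ?_ ?_ ?_
  · exact (((ha.const_mul (D.s j : ℝ)).div_const 2).const_add
      (Real.pi / 4 * D.x (j - 3) : ℝ)).congr_deriv (by ring)
  · exact (((ha.sin.const_mul (D.s (j - 1) : ℝ)).const_mul (1 / 2)).const_add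
      (Real.pi / 4 * D.x (j - 1) : ℝ)).congr_deriv (by ring)
  · exact (((ha.cos.const_mul (tau j * D.s (j - 1) * D.s j : ℝ)).const_mul (1 / 2)).const_sub
      (Real.pi / 4 * D.x (j - 2) : ℝ)).congr_deriv (by ring)

theorem hasDerivAt_runVel (j : ℤ) (x : ℝ) : HasDerivAt (D.runVel j) (D.runAcc j x) x := by
  have ha := D.hasDerivAt_angle j x
  have hs : (1 / helixSpeed) * (1 / helixSpeed) = 2 := by
    have := helixSpeed_sq
    have h0 := helixSpeed_pos.ne'
    field_simp
    linarith
  have h := (hasDerivAt_tri j (hasDerivAt_const x (D.s j / 2 : ℝ))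
    ((ha.cos.const_mul (D.s (j - 1) : ℝ)).div_const 2)
    ((ha.sin.const_mul (tau j * D.s (j - 1) * D.s j : ℝ)).div_const 2)).const_smul (1 / helixSpeed)
  refine HasDerivAt.congr_deriv h ?_
  rw [tri_smul, runAcc]
  congr 1
  · ring
  · linear_combination -(D.s (j - 1) * Real.sin (D.angle j x) / 2 : ℝ) * hs
  · linear_combination (tau j * D.s (j - 1) * D.s j * Real.cos (D.angle j x) / 2 : ℝ) * hs

theorem norm_runVel (j : ℤ) (x : ℝ) : ‖D.runVel j x‖ = 1 := by
  have e1 := D.s_mul_self' (j - 1)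
  have e2 := D.s_mul_self' j
  have e3 : (tau j : ℝ) * tau j = 1 := by exact_mod_cast tau_mul_self j
  have e4 := Real.sin_sq_add_cos_sq (D.angle j x)
  have hs := helixSpeed_sq
  have h0 := helixSpeed_pos
  have h1 : ‖D.runVel j x‖ ^ 2 = 1 := by
    rw [runVel, norm_smul, mul_pow, norm_sq_tri, Real.norm_of_nonneg (by positivity), div_pow,
      one_pow, hs]
    linear_combination (1 / 2) * e2 + (1 / 2) * Real.cos (D.angle j x) ^ 2 * e1 +
      (1 / 2) * Real.sin (D.angle j x) ^ 2 * (((D.s j : ℝ) * D.s j) * (D.s (j - 1) * D.s (j - 1)) * e3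
        + (D.s (j - 1) : ℝ) * D.s (j - 1) * e2 + e1) + (1 / 2) * e4
  exact (pow_eq_one_iff_of_nonneg (norm_nonneg _) two_ne_zero).1 h1

theorem norm_runAcc (j : ℤ) (x : ℝ) : ‖D.runAcc j x‖ = 1 := by
  have e1 := D.s_mul_self' (j - 1)
  have e2 := D.s_mul_self' j
  have e3 : (tau j : ℝ) * tau j = 1 := by exact_mod_cast tau_mul_self j
  have e4 := Real.sin_sq_add_cos_sq (D.angle j x)
  have h1 : ‖D.runAcc j x‖ ^ 2 = 1 := by
    rw [runAcc, norm_sq_tri]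
    linear_combination Real.sin (D.angle j x) ^ 2 * e1 +
      Real.cos (D.angle j x) ^ 2 * (((D.s j : ℝ) * D.s j) * (D.s (j - 1) * D.s (j - 1)) * e3
        + (D.s (j - 1) : ℝ) * D.s (j - 1) * e2 + e1) + e4
  exact (pow_eq_one_iff_of_nonneg (norm_nonneg _) two_ne_zero).1 h1

/-- The arclength parametrization of the helical curve. -/
noncomputable def arcCurve : ℝ → E3 := D.gluing.glue D.run

theorem hasDerivAt_arcCurve (x : ℝ) : HasDerivAt D.arcCurve (D.gluing.glue D.runVel x) x :=
  D.gluing.hasDerivAt_glue D.run_match D.runVel_match D.hasDerivAt_run x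

theorem deriv_arcCurve : deriv D.arcCurve = D.gluing.glue D.runVel :=
  funext fun x => (D.hasDerivAt_arcCurve x).deriv

theorem hasDerivAt_deriv_arcCurve (x : ℝ) :
    HasDerivAt (D.gluing.glue D.runVel) (D.gluing.glue D.runAcc x) x :=
  D.gluing.hasDerivAt_glue D.runVel_match D.runAcc_match D.hasDerivAt_runVel x

theorem deriv_deriv_arcCurve : deriv (deriv D.arcCurve) = D.gluing.glue D.runAcc := by
  rw [deriv_arcCurve]
  exact funext fun x => (D.hasDerivAt_deriv_arcCurve x).deriv

theorem continuous_runAcc (j : ℤ) : Continuous (D.runAcc j) := by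
  have h : Continuous (D.angle j) := by unfold angle; fun_prop
  have e : D.runAcc j = fun x => (-(D.s (j - 1) * Real.sin (D.angle j x)) : ℝ) • tri j 0 1 0 +
      (tau j * D.s (j - 1) * D.s j * Real.cos (D.angle j x) : ℝ) • tri j 0 0 1 := by
    ext1 x
    rw [runAcc, tri_smul, tri_smul, tri_add]
    congr 1 <;> ring
  rw [e]
  fun_prop

theorem contDiff_arcCurve : ContDiff ℝ 2 D.arcCurve := by
  rw [show (2 : WithTop ℕ∞) = 1 + 1 by norm_num, contDiff_succ_iff_deriv]
  refine ⟨fun x => (D.hasDerivAt_arcCurve x).differentiableAt, by simp, ?_⟩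
  rw [contDiff_one_iff_deriv]
  refine ⟨fun x => ?_, ?_⟩
  · rw [deriv_arcCurve]; exact (D.hasDerivAt_deriv_arcCurve x).differentiableAt
  · rw [deriv_deriv_arcCurve]
    exact D.gluing.continuous_glue D.runAcc_match D.continuous_runAcc

/-- The arclength of the helical curve. -/
noncomputable def totalLength : ℝ := D.start D.J * quarterLength

theorem start_add_mul (j z : ℤ) : D.start (j + z * D.J) = D.start j + z * D.start D.J :=
  cumul_add_mul D.J_pos.ne' D.len_add j z

theorem start_zero : D.start 0 = 0 := cumul_zero _

theorem start_J_pos : 0 < D.start D.J := by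
  rw [← D.start_zero]; exact cumul_strictMono D.one_le_len D.J_pos

theorem arcCurve_eq {j : ℤ} {x : ℝ} (h : D.start j * quarterLength ≤ x)
    (h' : x ≤ D.start (j + 1) * quarterLength) : D.arcCurve x = D.run j x :=
  D.gluing.glue_eq D.run_match h h'

theorem arcCurve_periodic : Function.Periodic D.arcCurve D.totalLength := by
  intro x
  obtain ⟨h1, h2⟩ := D.gluing.idx_spec x
  set j := D.gluing.idx x
  change D.start j * quarterLength ≤ x at h1
  change x < D.start (j + 1) * quarterLength at h2
  have e1 : D.start (j + D.J) = D.start j + D.start D.J := by simpa using D.start_add_mul j 1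
  have e2 : D.start (j + D.J + 1) = D.start (j + 1) + D.start D.J := by
    rw [show j + D.J + 1 = j + 1 + D.J by ring]; simpa using D.start_add_mul (j + 1) 1
  rw [D.arcCurve_eq h1 h2.le, D.arcCurve_eq (j := j + D.J), run, run, helix_add]
  · congr 1
    rw [angle, angle, totalLength, e1, add_div, mul_div_assoc _ quarterLength, quarterLength_div]
    push_cast; ring
  · rw [e1, totalLength]; push_cast; linarith
  · rw [e2, totalLength]; push_cast; linarith

/-- The arclength as a function of the parameter that takes unit time for each run. -/
noncomputable def arclength (u : ℝ) : ℝ :=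
  (D.start ⌊u⌋ + Int.fract u * D.len ⌊u⌋) * quarterLength

theorem arcCurve_arclength (u : ℝ) : D.arcCurve (D.arclength u) = D.curve (1 / 2) u := by
  have h0 := Int.fract_nonneg u
  have h1 := (Int.fract_lt_one u).le
  have h7 := D.seven_le_len ⌊u⌋
  have hq := quarterLength_pos
  have h2 : 0 ≤ Int.fract u * D.len ⌊u⌋ := by positivity
  have h3 : Int.fract u * D.len ⌊u⌋ ≤ D.len ⌊u⌋ := mul_le_of_le_one_left (by linarith) h1
  rw [D.arcCurve_eq (j := ⌊u⌋), run, curve, angle, arclength, mul_div_assoc, quarterLength_div]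
  · congr 1; ring
  · rw [arclength]; gcongr; linarith
  · rw [arclength, start_succ]; push_cast; gcongr

theorem arclength_surjective : Function.Surjective D.arclength := by
  intro x
  obtain ⟨h1, h2⟩ := D.gluing.idx_spec x
  set j := D.gluing.idx x
  change D.start j * quarterLength ≤ x at h1
  change x < D.start (j + 1) * quarterLength at h2
  have hq := quarterLength_pos
  have h7 := D.seven_le_len j
  rw [start_succ] at h2
  push_cast at h2
  have hl : (0 : ℝ) < D.len j := by linarith
  set t := (x / quarterLength - D.start j) / D.len j with ht
  have t0 : 0 ≤ t := by
    apply div_nonneg _ hl.le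
    rw [sub_nonneg, le_div_iff₀ hq]; exact h1
  have t1 : t < 1 := by
    rw [ht, div_lt_one hl, sub_lt_iff_lt_add, div_lt_iff₀ hq, add_comm]; exact h2
  refine ⟨j + t, ?_⟩
  have e1 : ⌊(j : ℝ) + t⌋ = j := by rw [Int.floor_eq_iff]; constructor <;> linarith
  rw [arclength, Int.fract, e1, add_sub_cancel_left, ht]
  field_simp
  ring

theorem arclength_add (u : ℝ) (z : ℤ) :
    D.arclength (u + z * D.J) = D.arclength u + z * D.totalLength := by
  have e1 : ⌊u + z * D.J⌋ = ⌊u⌋ + z * D.J := by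
    have := Int.floor_add_intCast u (z * D.J); push_cast at this; exact this
  have e2 : Int.fract (u + z * D.J) = Int.fract u := by
    have := Int.fract_add_intCast u (z * D.J); push_cast at this; exact this
  have e3 : D.len (⌊u⌋ + z * D.J) = D.len ⌊u⌋ := by
    have hp : Function.Periodic D.len D.J := D.len_add
    simpa using hp.int_mul z ⌊u⌋
  rw [arclength, arclength, e1, e2, e3, start_add_mul, totalLength]
  push_cast; ring

end RunData

theorem ax_sub_one (j : ℤ) : ax (j - 1) = ax j - 1 := by
  change ((j - 1 : ℤ) : ZMod 3) = (j : ZMod 3) - 1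
  push_cast; rfl

theorem exists_rotation (j : ℤ) (θ : ℝ) {p q r : ℝ} (hp : p * p = 1) (hq : q * q = 1)
    (hr : r * r = 1) (hpqr : p * q * r = 1) :
    ∃ A : E3 ≃ₗᵢ[ℝ] E3, LinearMap.det (A.toLinearEquiv : E3 →ₗ[ℝ] E3) = 1 ∧
      ∀ v, A v = tri j (p * v 2) (q * (v 0 * Real.sin θ + v 1 * Real.cos θ))
        (r * (v 0 * Real.cos θ - v 1 * Real.sin θ)) := by
  have hθ := Real.sin_sq_add_cos_sq θ
  let f : E3 →ₗ[ℝ] E3 :=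
    { toFun v := tri j (p * v 2) (q * (v 0 * Real.sin θ + v 1 * Real.cos θ))
        (r * (v 0 * Real.cos θ - v 1 * Real.sin θ))
      map_add' v w := by
        rw [tri_add]; simp only [PiLp.add_apply]; congr 1 <;> ring
      map_smul' c v := by
        rw [RingHom.id_apply, tri_smul]; simp only [PiLp.smul_apply, smul_eq_mul]
        congr 1 <;> ring }
  have hf : ∀ v, f v = tri j (p * v 2) (q * (v 0 * Real.sin θ + v 1 * Real.cos θ))
        (r * (v 0 * Real.cos θ - v 1 * Real.sin θ)) := fun _ => rfl
  have hnorm : ∀ v, ‖f v‖ = ‖v‖ := by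
    intro v
    rw [← sq_eq_sq₀ (norm_nonneg _) (norm_nonneg _), hf, norm_sq_tri, EuclideanSpace.norm_sq_eq,
      Fin.sum_univ_three]
    simp only [Real.norm_eq_abs, sq_abs]
    linear_combination v 2 ^ 2 * hp + (v 0 * Real.sin θ + v 1 * Real.cos θ) ^ 2 * hq +
      (v 0 * Real.cos θ - v 1 * Real.sin θ) ^ 2 * hr + (v 0 ^ 2 + v 1 ^ 2) * hθ
  let g : E3 →ₗᵢ[ℝ] E3 := ⟨f, hnorm⟩
  refine ⟨g.toLinearIsometryEquiv rfl, ?_, fun v => rfl⟩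
  have hg : ((g.toLinearIsometryEquiv rfl).toLinearEquiv : E3 →ₗ[ℝ] E3) = f :=
    LinearMap.ext fun _ => rfl
  rw [hg, ← LinearMap.det_toMatrix (EuclideanSpace.basisFun (Fin 3) ℝ).toBasis,
    Matrix.det_fin_three]
  simp only [LinearMap.toMatrix_apply, OrthonormalBasis.coe_toBasis,
    OrthonormalBasis.coe_toBasis_repr_apply, EuclideanSpace.basisFun_repr,
    EuclideanSpace.basisFun_apply, hf, PiLp.single_apply, tri, ax_sub_one]
  have h3 : ax j = 0 ∧ ax j - 1 = 2 ∨ ax j = 1 ∧ ax j - 1 = 0 ∨ ax j = 2 ∧ ax j - 1 = 1 := by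
    generalize ax j = a; revert a; decide
  rcases h3 with ⟨h, h'⟩ | ⟨h, h'⟩ | ⟨h, h'⟩ <;> rw [h', h] <;> simp <;>
    linear_combination (p * q * r) * hθ + hpqr

namespace RunData
variable (D : RunData)

theorem exists_elementaryPiece (j : ℤ) : ∃ p ∈ elementaryPieces, p.length = quarterLength ∧
    ∀ s, p.arc s = !₂[1 / 2 * Real.cos (s / helixSpeed), 1 / 2 * Real.sin (s / helixSpeed),
      -tau j / 2 * (s / helixSpeed)] := by
  by_cases hj : Even j
  · refine ⟨⟨1 / 2, -1 / 2, 0, Real.pi / 2⟩, by simp [elementaryPieces], ?_, fun s => ?_⟩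
    · rw [HelixPiece.length, quarterLength, helixSpeed, sub_zero]; norm_num
    · have : √((1 / 2 : ℝ) ^ 2 + (-1 / 2) ^ 2) = helixSpeed := by rw [helixSpeed]; norm_num
      simp only [HelixPiece.arc, this, zero_add]
      rw [tau, if_pos hj, Int.cast_one]
  · refine ⟨⟨1 / 2, 1 / 2, 0, Real.pi / 2⟩, by simp [elementaryPieces], ?_, fun s => ?_⟩
    · rw [HelixPiece.length, quarterLength, helixSpeed, sub_zero]
    · have : √((1 / 2 : ℝ) ^ 2 + (1 / 2) ^ 2) = helixSpeed := rfl
      simp only [HelixPiece.arc, this, zero_add]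
      rw [tau, if_neg hj]; norm_num

theorem isConcat_arcCurve : IsConcatOfElementaryPieces D.arcCurve D.totalLength := by
  refine ⟨(D.start D.J).toNat, fun k => (k : ℕ) * quarterLength, by simp, ?_, fun k => ?_⟩
  · beta_reduce
    rw [Fin.val_last, totalLength]
    congr 1
    exact_mod_cast Int.toNat_of_nonneg D.start_J_pos.le
  obtain ⟨j, h1, h2⟩ := D.exists_start_le_lt (k : ℕ)
  have h3 : (k : ℝ) + 1 ≤ D.start (j + 1) := by
    have : ((k : ℕ) : ℤ) < D.start (j + 1) := by exact_mod_cast h2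
    exact_mod_cast (show ((k : ℕ) : ℤ) + 1 ≤ D.start (j + 1) by omega)
  obtain ⟨p, hp, hlen, harc⟩ := exists_elementaryPiece j
  have e1 := D.s_mul_self' (j - 1)
  have e2 := D.s_mul_self' j
  have e3 : (tau j : ℝ) * tau j = 1 := by exact_mod_cast tau_mul_self j
  set θ := ((k : ℕ) - D.start j : ℝ) * (Real.pi / 2) with hθ
  obtain ⟨A, hA, hA'⟩ := exists_rotation j θ (p := -(tau j * D.s j)) (q := D.s (j - 1))
    (r := -(tau j * D.s (j - 1) * D.s j))
    (by linear_combination (tau j * tau j : ℝ) * e2 + e3) e1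
    (by linear_combination ((tau j * tau j : ℝ) * (D.s j * D.s j)) * e1 +
      (tau j * tau j : ℝ) * e2 + e3)
    (by linear_combination ((tau j * tau j : ℝ) * (D.s j * D.s j)) * e1 +
      (tau j * tau j : ℝ) * e2 + e3)
  refine ⟨p, hp, A, tri j (Real.pi / 4 * D.x (j - 3) + D.s j * θ / 2) (Real.pi / 4 * D.x (j - 1))
    (Real.pi / 4 * D.x (j - 2)), hA, ?_, fun s hs => ?_⟩
  · beta_reduce
    rw [hlen, Fin.val_succ, Fin.val_castSucc]; push_cast; ring
  beta_reduce
  rw [hlen] at hs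
  have hq := quarterLength_pos
  have ha : D.angle j ((k : ℕ) * quarterLength + s) = θ + s / helixSpeed := by
    rw [angle, add_div, mul_div_assoc, quarterLength_div, hθ]; ring
  rw [Fin.val_castSucc, D.arcCurve_eq (j := j), run, helix, ha, hA', harc, tri_add]
  · simp only [Matrix.cons_val]
    congr 1
    · linear_combination (-(D.s j : ℝ) * (s / helixSpeed) / 2) * e3
    · rw [Real.sin_add]; ring
    · rw [Real.cos_add]; ring
  · have := mul_le_mul_of_nonneg_right h1 hq.le
    linarith [hs.1]
  · have := mul_le_mul_of_nonneg_right h3 hq.le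
    linarith [hs.2]

theorem totalLength_pos : 0 < D.totalLength :=
  mul_pos (by exact_mod_cast D.start_J_pos) quarterLength_pos

theorem curvature_arcCurve (s : ℝ) : curvature D.arcCurve s = 1 := by
  rw [curvature, deriv_deriv_arcCurve]; exact D.norm_runAcc _ _

theorem norm_deriv_arcCurve (s : ℝ) : ‖deriv D.arcCurve s‖ = 1 := by
  rw [deriv_arcCurve]; exact D.norm_runVel _ _

theorem range_arcCurve : range D.arcCurve = range (D.curve (1 / 2)) := by
  rw [← D.arclength_surjective.range_comp]
  exact congrArg range (funext D.arcCurve_arclength)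

/-- The link made of the arclength parametrized helical curves. -/
noncomputable def helicalLink {n : ℕ} (D : Fin n → RunData)
    (h : ∀ i j u v, (D i).curve (1 / 2) u = (D j).curve (1 / 2) v →
      i = j ∧ ∃ z : ℤ, v = u + z * ((D i).J : ℝ)) : C2Link n where
  length i := (D i).totalLength
  length_pos i := (D i).totalLength_pos
  γ i := (D i).arcCurve
  contDiff i := (D i).contDiff_arcCurve
  unitSpeed i := (D i).norm_deriv_arcCurve
  periodic i := (D i).arcCurve_periodic
  simple i j s t hst := by
    obtain ⟨u, rfl⟩ := (D i).arclength_surjective s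
    obtain ⟨v, rfl⟩ := (D j).arclength_surjective t
    rw [arcCurve_arclength, arcCurve_arclength] at hst
    obtain ⟨rfl, z, rfl⟩ := h i j u v hst
    exact ⟨rfl, z, (D i).arclength_add u z⟩

end RunData

/-- Every link with `n` components (every knot, for `n = 1`) is ambient isotopic to a `C²` link all
of whose components have constant curvature one, each component being spliced from finitely many
copies of the elementary circle and helix pieces. -/
theorem mainTheorem1 (n : ℕ) (L : Set E3) (hL : IsTameLink n L) :
    ∃ C : C2Link n, AmbientIsotopic L C.carrier ∧ C.HasConstantCurvature 1 ∧
      ∀ i, IsConcatOfElementaryPieces (C.γ i) (C.length i) := by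
  obtain ⟨P, hP⟩ := hL
  obtain ⟨Q, Q', hper, hper', hd, hc, ⟨Λ, hΛ⟩, hgen, hinj, hPQ⟩ := P.exists_generic_curve
  have hm : ∀ i, (0 : ℝ) < P.m i := fun i => by exact_mod_cast P.m_pos i
  obtain ⟨c, hc0, η, hη, hwin⟩ := exists_uniform_windows hm hper' hd hc hgen
  have hlip : ∀ i u v, ‖Q i v - Q i u‖ ≤ max Λ 0 * |v - u| := fun i u v => by
    rw [← Real.norm_eq_abs]
    exact convex_univ.norm_image_sub_le_of_norm_hasDerivWithin_le
      (fun x _ => (hd i x).hasDerivWithinAt) (fun x _ => (hΛ i x).trans (le_max_left _ _))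
      (mem_univ u) (mem_univ v)
  obtain ⟨D, w, hw1, hw, far, hQD⟩ :=
    exists_runData P.m_pos hper (le_max_right Λ 0) hlip hc0 hη hwin hinj
  obtain ⟨hDD, hDinj⟩ := RunData.ambientIsotopic_core_helix D hw1 hw far
  refine ⟨RunData.helicalLink D hDinj, ?_, fun i s => (D i).curvature_arcCurve s,
    fun i => (D i).isConcat_arcCurve⟩
  have hC : (RunData.helicalLink D hDinj).carrier = carrierOf fun i => (D i).curve (1 / 2) :=
    iUnion_congr fun i => (D i).range_arcCurve
  rw [hC]
  exact hP.symm.trans (hPQ.trans (hQD.trans hDD))
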